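/- **Setting.** Let $n\ge 1$, $p\ge 0$, and let $\mathcal G$ be a strongly connected directed graph on the agents $\{1,\dots,n\}$. Let $\underline A=(a_{ij})$, $\underline B=(b_{ij})$ be real $n\times n$ matrices such that $a_{ij},b_{ij}>0$ if $j=i$ or $j$ can send information to $i$ (i.e. $j\to i$ is an edge), $a_{ij}=b_{ij}=0$ otherwise, $\sum_j a_{ij}=1$ for all $i$ and $\sum_i b_{ij}=1$ for all $j$. Let $f_1,\dots,f_n:\mathbb R^p\to\mathbb R$ be differentiable and $\alpha,\beta>0$ be such that for all $i$ and all $u,v\in\mathbb R^p$ $$\|\nabla f_i(u)-\nabla f_i(v)\|_2\le\beta\|u-v\|_2,\qquad f_i(u)-f_i(v)\le\nabla f_i(u)^\top(u-v)-\tfrac{\alpha}{2}\|u-v\|_2^2 .$$ For a step-size $\eta>0$ and arbitrary $x_i(0)\in\mathbb R^p$, let $y_i(0)=\nabla f_i(x_i(0))$ and, for $k\ge 0$, $$x_i(k+1)=\sum_{j}a_{ij}x_j(k)-\eta\, y_i(k),\qquad y_i(k+1)=\sum_{j}b_{ij}\big(y_j(k)+\nabla f_j(x_j(k+1))-\nabla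 f_j(x_j(k))\big),$$ and let $\mathbf x(k),\mathbf y(k)\in\mathbb R^{np}$ be the stacked vectors. Put $A=\underline A\otimes I_p$ and $B=\underline B\otimes I_p$. Write $\|\cdot\|_2$ for the Euclidean norm and $|||\cdot|||_2$ for the spectral norm. **Theorem.** (a) There are a unique $\pi_r\in\mathbb R^n$ with $\pi_r^\top\underline A=\pi_r^\top$, $\pi_r^\top\mathbf 1_n=1$, a unique $\pi_c\in\mathbb R^n$ with $\underline B\pi_c=\pi_c$, $\mathbf 1_n^\top\pi_c=1$, and a unique minimizer $\mathbf x^*$ of $F=\frac1n\sum_i f_i$; the limits $A_\infty=\lim_k A^k$ and $B_\infty=\lim_k B^k$ exist; and there are norms $\|\cdot\|_A,\|\cdot\|_B$ on $\mathbb R^{np}$ and $\sigma_A,\sigma_B\in(0,1)$ such that for all $\mathbf a\in\mathbb R^{np}$ $$\|(A-A_\infty)\mathbf a\|_A\le\sigma_A\|\mathbf a\|_A,\qquad \|(B-B_\infty)\mathbf a\|_B\le\sigma_B\|\mathbf a\|_B, \tag{1}$$ and constants $g,h,l,m>0$ with $$\|\cdot\|_2\le g\|\cdot\|_A,\quad \|\cdot\|_2\le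 h\|\cdot\|_B,\quad \|\cdot\|_B\le l\|\cdot\|_2,\quad \|\cdot\|_A\le m\|\cdot\|_2. \tag{2}$$ Fix any norms $\|\cdot\|_A,\|\cdot\|_B$, any $\sigma_A,\sigma_B\in(0,1)$ and any $g,h,l,m>0$ satisfying (1) and (2). Let $$\begin{aligned}a_1&=mg\beta|||I-A_\infty|||_2|||B_\infty|||_2,& a_2&=m\beta|||I-A_\infty|||_2|||B_\infty|||_2,& a_3&=mh|||I-A_\infty|||_2,\\ a_4&=n\beta g\,\pi_r^\top\pi_c,& a_5&=h|||A_\infty|||_2,& a_6&=g\sigma_Bl\beta|||A-I|||_2,\\ a_7&=g\sigma_Bl\beta^2|||B_\infty|||_2,& a_8&=\sigma_Bl\beta^2|||B_\infty|||_2,& a_9&=h\sigma_Bl\beta,\end{aligned}$$ $\lambda=\lambda(\eta)=\max\{|1-\alpha n\eta\,\pi_r^\top\pi_c|,\,|1-\beta n\eta\,\pi_r^\top\pi_c|\}$, and $$J(\eta)=\begin{bmatrix}\sigma_A+a_1\eta&a_2\eta&a_3\eta\\ a_4\eta&\lambda&a_5\eta\\ a_6+a_7\eta&a_8\eta&\sigma_B+a_9\eta\end{bmatrix},\qquad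 \mathbf t(k)=\begin{bmatrix}\|\mathbf x(k)-A_\infty\mathbf x(k)\|_A\\ \|A_\infty\mathbf x(k)-\mathbf 1_n\otimes\mathbf x^*\|_2\\ \|\mathbf y(k)-B_\infty\mathbf y(k)\|_B\end{bmatrix}.$$ For $\eta>0$ the matrix $J(\eta)$ is entrywise nonnegative, and all $a_i$ are positive if $n\ge2$ and $p\ge 1$. (b) If $0<\eta<\dfrac{2}{n\beta\,\pi_r^\top\pi_c}$, then, for every initial point, $\mathbf t(k+1)\le J(\eta)\,\mathbf t(k)$ entrywise for all $k\ge0$. (c) Let $n\ge2$ and $p\ge1$. If $\epsilon_1,\epsilon_2,\epsilon_3>0$ satisfy $\epsilon_1<\dfrac{(1-\sigma_B)\epsilon_3}{a_6}$ and $\epsilon_2>\dfrac{a_4\epsilon_1+a_5\epsilon_3}{\alpha n\,\pi_r^\top\pi_c}$, and if $$0<\eta<\min\left\{\frac{\epsilon_1(1-\sigma_A)}{a_1\epsilon_1+a_2\epsilon_2+a_3\epsilon_3},\ \frac{(1-\sigma_B)\epsilon_3-\epsilon_1a_6}{a_7\epsilon_1+a_8\epsilon_2+a_9\epsilon_3},\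 \frac1{n\beta\,\pi_r^\top\pi_c}\right\},$$ then the spectral radius satisfies $\rho(J(\eta))<1$, and, for every initial point, $\|\mathbf x(k)-\mathbf 1_n\otimes\mathbf x^*\|_2$ tends to $0$ and is $O(\rho(J(\eta))^k)$ as $k\to\infty$. -/

import Mathlib

open Filter Topology
open scoped Kronecker Matrix Gradient

namespace DirOpt

/-- `ℝ^p` with the Euclidean norm. -/
abbrev Vec (p : ℕ) := EuclideanSpace ℝ (Fin p)

/-- `ℝ^{np}`, seen as `n` stacked blocks of length `p`, with the Euclidean norm. -/
abbrev StackedVec (n p : ℕ) := EuclideanSpace ℝ (Fin n × Fin p)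

/-- Real `np × np` matrices, indexed by (agent, coordinate). -/
abbrev BigMatrix (n p : ℕ) := Matrix (Fin n × Fin p) (Fin n × Fin p) ℝ

/-- The vector that stacks the local vectors `v 0, …, v (n-1)`. -/
def stack {n p : ℕ} (v : Fin n → Vec p) : StackedVec n p :=
  WithLp.toLp 2 fun ij => v ij.1 ij.2

/-! ### The communication graph and the weights -/

/-- Every agent can be reached from every other one along directed edges;
`G.Adj j i` means that agent `j` can send information to agent `i`. -/
def StronglyConnected {n : ℕ} (G : Digraph (Fin n)) : Prop :=
  ∀ u v : Fin n, Relation.ReflTransGen G.Adj u v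

/-- In-neighbours of `i`: the agents that can send information to `i`, and `i` itself. -/
def inNbrs {n : ℕ} (G : Digraph (Fin n)) (i : Fin n) : Set (Fin n) :=
  {j | j = i ∨ G.Adj j i}

/-- Out-neighbours of `j`: the agents that `j` can send information to, and `j` itself. -/
def outNbrs {n : ℕ} (G : Digraph (Fin n)) (j : Fin n) : Set (Fin n) :=
  {i | i = j ∨ G.Adj j i}

/-- Row-stochastic weights that are compatible with the graph. -/
structure IsRowWeights {n : ℕ} (G : Digraph (Fin n)) (A : Matrix (Fin n) (Fin n) ℝ) : Prop where
  pos : ∀ i j, j ∈ inNbrs G i → 0 < A i j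
  zero : ∀ i j, j ∉ inNbrs G i → A i j = 0
  row_sum : ∀ i, ∑ j, A i j = 1

/-- Column-stochastic weights that are compatible with the graph. -/
structure IsColWeights {n : ℕ} (G : Digraph (Fin n)) (B : Matrix (Fin n) (Fin n) ℝ) : Prop where
  pos : ∀ i j, i ∈ outNbrs G j → 0 < B i j
  zero : ∀ i j, i ∉ outNbrs G j → B i j = 0
  col_sum : ∀ j, ∑ i, B i j = 1

/-- `π` is the left eigenvector of `A` for the eigenvalue `1`, normalised to have sum `1`. -/
def IsLeftEigvec {n : ℕ} (A : Matrix (Fin n) (Fin n) ℝ) (π : Fin n → ℝ) : Prop :=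
  π ᵥ* A = π ∧ ∑ i, π i = 1

/-- `π` is the right eigenvector of `B` for the eigenvalue `1`, normalised to have sum `1`. -/
def IsRightEigvec {n : ℕ} (B : Matrix (Fin n) (Fin n) ℝ) (π : Fin n → ℝ) : Prop :=
  B *ᵥ π = π ∧ ∑ i, π i = 1

/-- The Kronecker product `A ⊗ I_p`. -/
def kronI {n : ℕ} (p : ℕ) (A : Matrix (Fin n) (Fin n) ℝ) : BigMatrix n p :=
  A ⊗ₖ (1 : Matrix (Fin p) (Fin p) ℝ)

/-- The infinite power `lim_k X ^ k` of a matrix. -/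
noncomputable def infPow {n p : ℕ} (X : BigMatrix n p) : BigMatrix n p :=
  limUnder atTop fun k : ℕ => X ^ k

/-- The matrix `X` as an operator on Euclidean `ℝ^{np}`. -/
noncomputable def toOp {n p : ℕ} (X : BigMatrix n p) : StackedVec n p →L[ℝ] StackedVec n p :=
  Matrix.toEuclideanCLM (𝕜 := ℝ) X

/-- The spectral norm of a matrix (its operator norm for the Euclidean norm). -/
noncomputable def specNorm {n p : ℕ} (X : BigMatrix n p) : ℝ := ‖toOp X‖

/-! ### The optimization problem and the algorithm -/

/-- The global objective, the average of the local functions. -/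
noncomputable def objective {n p : ℕ} (f : Fin n → Vec p → ℝ) (z : Vec p) : ℝ :=
  (1 / (n : ℝ)) * ∑ i, f i z

/-- `z` is a global minimizer of the average of the local functions. -/
def IsOptimal {n p : ℕ} (f : Fin n → Vec p → ℝ) (z : Vec p) : Prop :=
  ∀ w, objective f z ≤ objective f w

/-- Every local function is differentiable, with a `β`-Lipschitz gradient, and is
`α`-strongly convex. -/
structure IsAdmissible {n p : ℕ} (f : Fin n → Vec p → ℝ) (α β : ℝ) : Prop where
  alpha_pos : 0 < α
  beta_pos : 0 < β
  differentiable : ∀ i, Differentiable ℝ (f i)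
  lipschitz : ∀ i z w, ‖∇ (f i) z - ∇ (f i) w‖ ≤ β * ‖z - w‖
  strongly_convex : ∀ i z w,
    f i z - f i w ≤ inner ℝ (∇ (f i) z) (z - w) - α / 2 * ‖z - w‖ ^ 2

/-- The pair `(x_i(k), y_i(k))_i` of local variables after `k` iterations with step-size `η`,
started at `x_i(0) = x₀ i` and `y_i(0) = ∇ f_i (x_i(0))`. -/
noncomputable def iter {n p : ℕ} (A B : Matrix (Fin n) (Fin n) ℝ) (f : Fin n → Vec p → ℝ)
    (η : ℝ) (x₀ : Fin n → Vec p) : ℕ → (Fin n → Vec p) × (Fin n → Vec p)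
  | 0 => (x₀, fun i => ∇ (f i) (x₀ i))
  | k + 1 =>
    let x := (iter A B f η x₀ k).1
    let y := (iter A B f η x₀ k).2
    let x' : Fin n → Vec p := fun i => (∑ j, A i j • x j) - η • y i
    (x', fun i => ∑ j, B i j • (y j + ∇ (f j) (x' j) - ∇ (f j) (x j)))

/-- The stacked vector `x(k)`. -/
noncomputable def xIter {n p : ℕ} (A B : Matrix (Fin n) (Fin n) ℝ) (f : Fin n → Vec p → ℝ)
    (η : ℝ) (x₀ : Fin n → Vec p) (k : ℕ) : StackedVec n p :=
  stack (iter A B f η x₀ k).1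

/-- The stacked vector `y(k)`. -/
noncomputable def yIter {n p : ℕ} (A B : Matrix (Fin n) (Fin n) ℝ) (f : Fin n → Vec p → ℝ)
    (η : ℝ) (x₀ : Fin n → Vec p) (k : ℕ) : StackedVec n p :=
  stack (iter A B f η x₀ k).2

/-! ### Contraction norms, the error vector and the matrix `J(η)` -/

/-- `N` is a vector norm on `ℝ^{np}` and `σ ∈ (0, 1)` bounds the matrix norm that `N` induces
at `X - X_∞`. Since `X a - X_∞ a = (X - X_∞) (a - X_∞ a)`, it follows that
`N (X a - X_∞ a) ≤ σ * N (a - X_∞ a)`. -/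
structure IsContractionNorm {n p : ℕ} (X : BigMatrix n p) (N : Seminorm ℝ (StackedVec n p))
    (σ : ℝ) : Prop where
  definite : ∀ v, N v = 0 → v = 0
  sigma_pos : 0 < σ
  sigma_lt_one : σ < 1
  bound : ∀ v, N (toOp (X - infPow X) v) ≤ σ * N v

/-- Positive constants `g, h, l, m` that compare the norms `NA`, `NB` with the Euclidean norm. -/
structure IsEquivConsts {n p : ℕ} (NA NB : Seminorm ℝ (StackedVec n p)) (g h l m : ℝ) : Prop where
  g_pos : 0 < g
  h_pos : 0 < h
  l_pos : 0 < l
  m_pos : 0 < m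
  le_g : ∀ v, ‖v‖ ≤ g * NA v
  le_h : ∀ v, ‖v‖ ≤ h * NB v
  le_l : ∀ v, NB v ≤ l * ‖v‖
  le_m : ∀ v, NA v ≤ m * ‖v‖

/-- The error vector `(‖x - A_∞ x‖_A, ‖A_∞ x - 1 ⊗ x*‖₂, ‖y - B_∞ y‖_B)`, where the arguments
`Ainf`, `Binf` are the infinite powers and `z` is `x*`. -/
noncomputable def errorVec {n p : ℕ} (Ainf Binf : BigMatrix n p)
    (NA NB : Seminorm ℝ (StackedVec n p)) (z : Vec p) (x y : StackedVec n p) : Fin 3 → ℝ :=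
  ![NA (x - toOp Ainf x), ‖toOp Ainf x - stack (fun _ => z)‖, NB (y - toOp Binf y)]

/-- The matrix `J(η)`; `lam` is its middle entry, which depends on `η` as well. -/
def errorMatrix (σA σB lam η a₁ a₂ a₃ a₄ a₅ a₆ a₇ a₈ a₉ : ℝ) : Matrix (Fin 3) (Fin 3) ℝ :=
  !![σA + a₁ * η, a₂ * η, a₃ * η;
     a₄ * η, lam, a₅ * η;
     a₆ + a₇ * η, a₈ * η, σB + a₉ * η]

/-- The spectral radius of a real matrix: the largest modulus of a complex eigenvalue. -/
noncomputable def specRadius (J : Matrix (Fin 3) (Fin 3) ℝ) : ENNReal :=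
  spectralRadius ℂ (J.map (fun r : ℝ => (r : ℂ)))

end DirOpt

open DirOpt

namespace DirOpt

/-! ### Powers of primitive row-stochastic matrices -/

section Stochastic

variable {n : ℕ} {G : Digraph (Fin n)} {A B : Matrix (Fin n) (Fin n) ℝ}

/-! The existence statements rest on primitivity. Strong connectivity and positive diagonals make
some power of the row weights entrywise positive, and Doeblin's estimate then contracts the row
vectors of sum zero. This gives uniqueness of `π_r` and convergence of the powers to the matrix with
all rows `π_r`; the column weights follow by transposition. If `X ^ k → P`, then `(X - P) ^ k → 0`,
so a weighted sum of Euclidean norms along orbits of `X - P` is a norm in which `X - P` contracts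
(`PowLimit.exists_contractionNorm`). The minimizer comes from coercivity and strong convexity.

The error recursion rests on gradient tracking: `B_∞ y(k)` equals `B_∞` applied to the stacked local
gradients (`toOp_yIter`). Applying `A_∞` to the `x`-update therefore yields a gradient step for `∑
f_i` at the `π_r`-weighted mean, with step-size `η π_r·π_c`, perturbed by the two consensus errors.
The unperturbed step contracts by `λ`, because a gradient difference `∇f x - ∇f y` lies in the ball
with diameter from `α (x - y)` to `β (x - y)` (`norm_gradient_step_le`). The two other rows of `J`
follow from the contraction norms and the bound on `‖y‖` in `IsAdmissible.norm_yIter_le`.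

For convergence, the conditions on `η` say that `J ε < ε` entrywise for a positive vector `ε`, which
forces `ρ(J) < 1` through a weighted maximum norm. Since `J` is then entrywise positive, it has a
positive eigenvector `v`, with eigenvalue `r ≤ ρ(J)`. Domination by multiples of `v` gives the rate
`ρ(J) ^ k` without a polynomial factor. -/

theorem IsRowWeights.nonneg (hA : IsRowWeights G A) (i j : Fin n) : 0 ≤ A i j := by
  by_cases h : j ∈ inNbrs G i
  · exact (hA.pos i j h).le
  · exact (hA.zero i j h).ge

theorem IsRowWeights.diag_pos (hA : IsRowWeights G A) (i : Fin n) : 0 < A i i :=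
  hA.pos i i (Or.inl rfl)

theorem IsRowWeights.pow_nonneg (hA : IsRowWeights G A) (k : ℕ) (i j : Fin n) :
    0 ≤ (A ^ k) i j := by
  induction k generalizing i j with
  | zero => rw [pow_zero, Matrix.one_apply]; split_ifs <;> norm_num
  | succ k ih =>
    rw [pow_succ', Matrix.mul_apply]
    exact Finset.sum_nonneg fun l _ => mul_nonneg (hA.nonneg i l) (ih l j)

theorem IsRowWeights.pow_row_sum (hA : IsRowWeights G A) (k : ℕ) (i : Fin n) :
    ∑ j, (A ^ k) i j = 1 := by
  induction k generalizing i with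
  | zero => simp [Matrix.one_apply]
  | succ k ih =>
    simp only [pow_succ', Matrix.mul_apply]
    rw [Finset.sum_comm]
    simp [← Finset.mul_sum, ih, hA.row_sum]

theorem IsRowWeights.pow_succ_pos (hA : IsRowWeights G A) {k : ℕ} {i l j : Fin n}
    (hil : 0 < A i l) (hlj : 0 < (A ^ k) l j) : 0 < (A ^ (k + 1)) i j := by
  rw [pow_succ', Matrix.mul_apply]
  exact (mul_pos hil hlj).trans_le (Finset.single_le_sum
    (f := fun l => A i l * (A ^ k) l j)
    (fun l _ => mul_nonneg (hA.nonneg i l) (hA.pow_nonneg k l j)) (Finset.mem_univ l))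

theorem IsRowWeights.pow_pos_mono (hA : IsRowWeights G A) {k l : ℕ} (hkl : k ≤ l) {i j : Fin n}
    (h : 0 < (A ^ k) i j) : 0 < (A ^ l) i j := by
  induction l, hkl using Nat.le_induction with
  | base => exact h
  | succ l _ ih => exact hA.pow_succ_pos (hA.diag_pos i) ih

theorem IsRowWeights.exists_pow_pos (hA : IsRowWeights G A) (hG : StronglyConnected G) :
    ∃ N, ∀ i j, 0 < (A ^ N) i j := by
  have h : ∀ i j, ∃ k, 0 < (A ^ k) i j := by
    intro i j
    -- An edge into `i` is a positive entry in row `i`, so a directed path from `j` to `i` gives a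
    -- positive `(i, j)` entry of a power.
    induction hG j i with
    | refl => exact ⟨0, by simp⟩
    | tail _ hadj ih =>
      obtain ⟨k, hk⟩ := ih
      exact ⟨k + 1, hA.pow_succ_pos (hA.pos _ _ (Or.inr hadj)) hk⟩
  choose k hk using h
  -- The sum dominates every `k i j`, and the positive diagonal keeps positive entries positive in
  -- higher powers.
  refine ⟨∑ i, ∑ j, k i j, fun i j => hA.pow_pos_mono ?_ (hk i j)⟩
  exact (Finset.single_le_sum (f := fun j => k i j) (fun _ _ => Nat.zero_le _)
    (Finset.mem_univ j)).trans (Finset.single_le_sum (f := fun i => ∑ j, k i j)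
    (fun _ _ => Nat.zero_le _) (Finset.mem_univ i))

/-- A row-stochastic matrix with entries at least `δ` contracts the `ℓ¹`-norm on the vectors
of sum zero (Doeblin's condition). -/
theorem sum_abs_vecMul_le {P : Matrix (Fin n) (Fin n) ℝ} {δ : ℝ} (hδ : ∀ i j, δ ≤ P i j)
    (hP : ∀ i, ∑ j, P i j = 1) {w : Fin n → ℝ} (hw : ∑ i, w i = 0) :
    ∑ j, |(w ᵥ* P) j| ≤ (1 - n * δ) * ∑ i, |w i| := by
  have h : ∀ j, |(w ᵥ* P) j| ≤ ∑ i, |w i| * (P i j - δ) := by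
    intro j
    -- As `w` has sum zero, subtracting the constant `δ` from column `j` changes nothing; this is
    -- where the gain comes from.
    have : (w ᵥ* P) j = ∑ i, w i * (P i j - δ) := by
      simp [Matrix.vecMul, dotProduct, mul_sub, ← Finset.sum_mul, hw]
    rw [this]
    refine (Finset.abs_sum_le_sum_abs _ _).trans (Finset.sum_le_sum fun i _ => ?_)
    rw [abs_mul, abs_of_nonneg (sub_nonneg.2 (hδ i j))]
  refine (Finset.sum_le_sum fun j _ => h j).trans_eq ?_
  rw [Finset.sum_comm, Finset.mul_sum]
  refine Finset.sum_congr rfl fun i _ => ?_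
  rw [← Finset.mul_sum, Finset.sum_sub_distrib, hP]
  simp [mul_comm]

theorem sum_vecMul_eq {P : Matrix (Fin n) (Fin n) ℝ} (hP : ∀ i, ∑ j, P i j = 1)
    (w : Fin n → ℝ) : ∑ j, (w ᵥ* P) j = ∑ i, w i := by
  simp only [Matrix.vecMul, dotProduct]
  rw [Finset.sum_comm]
  simp [← Finset.mul_sum, hP]

theorem IsRowWeights.exists_contraction (hA : IsRowWeights G A) (hG : StronglyConnected G)
    (hn : 0 < n) : ∃ (N : ℕ) (q : ℝ), 0 ≤ q ∧ q < 1 ∧ ∀ w : Fin n → ℝ, ∑ i, w i = 0 →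
      ∑ j, |(w ᵥ* A ^ N) j| ≤ q * ∑ i, |w i| := by
  obtain ⟨N, hN⟩ := hA.exists_pow_pos hG
  have : Nonempty (Fin n) := ⟨⟨0, hn⟩⟩
  obtain ⟨x, hx⟩ := Finite.exists_min fun x : Fin n × Fin n => (A ^ N) x.1 x.2
  set δ := (A ^ N) x.1 x.2 with hδ
  have hδ0 : 0 < δ := hN _ _
  have hle : ∀ i j, δ ≤ (A ^ N) i j := fun i j => hx (i, j)
  refine ⟨N, 1 - n * δ, ?_, ?_, fun w hw => sum_abs_vecMul_le hle (hA.pow_row_sum N) hw⟩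
  · have := Finset.sum_le_sum fun j (_ : j ∈ Finset.univ) => hle ⟨0, hn⟩ j
    rw [hA.pow_row_sum] at this
    simp at this
    linarith
  · have : (0 : ℝ) < n := by exact_mod_cast hn
    nlinarith

theorem IsRowWeights.eq_zero_of_fixed (hA : IsRowWeights G A) (hG : StronglyConnected G)
    (hn : 0 < n) {w : Fin n → ℝ} (hw : ∑ i, w i = 0) (hfix : w ᵥ* A = w) : w = 0 := by
  obtain ⟨N, q, -, hq1, hq⟩ := hA.exists_contraction hG hn
  have hfixN : ∀ k, w ᵥ* A ^ k = w := by
    intro k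
    induction k with
    | zero => simp
    | succ k ih => rw [pow_succ, ← Matrix.vecMul_vecMul, ih, hfix]
  have h := hq w hw
  rw [hfixN] at h
  have h0 : 0 ≤ ∑ i, |w i| := Finset.sum_nonneg fun i _ => abs_nonneg _
  have h1 : ∑ i, |w i| = 0 := by nlinarith
  ext i
  exact abs_eq_zero.1 ((Finset.sum_eq_zero_iff_of_nonneg fun i _ => abs_nonneg (w i)).1 h1 i
    (Finset.mem_univ i))

/-- Since `A - 1` kills the constant vector, it is singular and also has a left null vector. Its sum
cannot vanish, because Doeblin's contraction leaves no nonzero fixed vector of sum zero; so it can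
be normalised, and the same fact gives uniqueness. -/
theorem IsRowWeights.existsUnique_leftEigvec (hA : IsRowWeights G A) (hG : StronglyConnected G)
    (hn : 0 < n) : ∃! π, IsLeftEigvec A π := by
  have hone : (A - 1) *ᵥ (fun _ => 1) = 0 := by
    ext i
    simp [Matrix.mulVec, dotProduct, hA.row_sum, Matrix.one_apply]
  have hdet : (A - 1).det = 0 := by
    refine Matrix.exists_mulVec_eq_zero_iff.1 ⟨_, ?_, hone⟩
    intro h
    have := congrFun h ⟨0, hn⟩
    simp at this
  obtain ⟨v, hv0, hv⟩ := Matrix.exists_vecMul_eq_zero_iff.2 hdet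
  rw [Matrix.vecMul_sub, Matrix.vecMul_one, sub_eq_zero] at hv
  have hs : ∑ i, v i ≠ 0 := fun h => hv0 (hA.eq_zero_of_fixed hG hn h hv)
  refine ⟨(∑ i, v i)⁻¹ • v, ⟨?_, ?_⟩, ?_⟩
  · rw [Matrix.smul_vecMul, hv]
  · simp [← Finset.mul_sum, hs]
  · rintro w ⟨hw, hw1⟩
    rw [← sub_eq_zero]
    refine hA.eq_zero_of_fixed hG hn ?_ ?_
    · simp [← Finset.mul_sum, hs, hw1]
    · rw [Matrix.sub_vecMul, Matrix.smul_vecMul, hv, hw]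

theorem IsRowWeights.tendsto_vecMul_pow (hA : IsRowWeights G A) (hG : StronglyConnected G)
    (hn : 0 < n) {w : Fin n → ℝ} (hw : ∑ i, w i = 0) :
    Tendsto (fun k : ℕ => w ᵥ* A ^ k) atTop (𝓝 0) := by
  obtain ⟨N, q, hq0, hq1, hq⟩ := hA.exists_contraction hG hn
  set s : ℕ → ℝ := fun k => ∑ j, |(w ᵥ* A ^ k) j| with hs
  have hsum : ∀ k, ∑ j, (w ᵥ* A ^ k) j = 0 := fun k => by
    rw [sum_vecMul_eq (hA.pow_row_sum k), hw]
  -- Doeblin's estimate with `δ = 0` is plain nonexpansiveness of the `ℓ¹`-norm.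
  have hanti : Antitone s := antitone_nat_of_succ_le fun k => by
    have := sum_abs_vecMul_le (δ := 0) hA.nonneg hA.row_sum (hsum k)
    rw [Matrix.vecMul_vecMul, ← pow_succ] at this
    simpa using this
  have hs0 : ∀ k, 0 ≤ s k := fun k => Finset.sum_nonneg fun i _ => abs_nonneg _
  -- The stride is `N + 1` rather than `N` because `N` may be `0`, and the subsequence has to be
  -- unbounded for monotonicity to give the full limit.
  have hgeo : ∀ k, s ((N + 1) * k) ≤ q ^ k * s 0 := by
    intro k
    induction k with
    | zero => simp
    | succ k ih =>
      have h1 := hq _ (hsum ((N + 1) * k))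
      rw [Matrix.vecMul_vecMul, ← pow_add] at h1
      have h2 : s ((N + 1) * (k + 1)) ≤ s ((N + 1) * k + N) := hanti (by lia)
      calc s ((N + 1) * (k + 1)) ≤ q * s ((N + 1) * k) := h2.trans h1
        _ ≤ q * (q ^ k * s 0) := mul_le_mul_of_nonneg_left ih hq0
        _ = q ^ (k + 1) * s 0 := by ring
  have hsub : Tendsto (fun k => s ((N + 1) * k)) atTop (𝓝 0) := by
    refine squeeze_zero (fun k => hs0 _) hgeo ?_
    simpa using (tendsto_pow_atTop_nhds_zero_of_lt_one hq0 hq1).mul_const (s 0)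
  have hlim : Tendsto s atTop (𝓝 0) := by
    refine tendsto_order.2 ⟨fun a ha => Eventually.of_forall fun k => ha.trans_le (hs0 k), ?_⟩
    intro a ha
    obtain ⟨k, hk⟩ := ((tendsto_order.1 hsub).2 a ha).exists
    filter_upwards [eventually_ge_atTop ((N + 1) * k)] with l hl using (hanti hl).trans_lt hk
  refine tendsto_pi_nhds.2 fun j => ?_
  refine squeeze_zero_norm (fun k => ?_) hlim
  exact Finset.single_le_sum (f := fun j => |(w ᵥ* A ^ k) j|) (fun _ _ => abs_nonneg _)
    (Finset.mem_univ j)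

theorem IsLeftEigvec.vecMul_pow {π : Fin n → ℝ} (hπ : IsLeftEigvec A π) (k : ℕ) :
    π ᵥ* A ^ k = π := by
  induction k with
  | zero => simp
  | succ k ih => rw [pow_succ, ← Matrix.vecMul_vecMul, ih, hπ.1]

theorem IsRowWeights.tendsto_pow (hA : IsRowWeights G A) (hG : StronglyConnected G)
    (hn : 0 < n) {π : Fin n → ℝ} (hπ : IsLeftEigvec A π) :
    Tendsto (fun k : ℕ => A ^ k) atTop (𝓝 (Matrix.of fun _ j => π j)) := by
  refine tendsto_pi_nhds.2 fun i => ?_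
  -- Row `i` of `A ^ k` differs from `π` by `(e_i - π) A ^ k`, and `e_i - π` has sum zero.
  have h := hA.tendsto_vecMul_pow hG hn (w := Pi.single i 1 - π) (by simp [hπ.2])
  have h2 := h.add_const π
  simp only [Matrix.sub_vecMul, hπ.vecMul_pow, sub_add_cancel, zero_add] at h2
  convert h2 using 2 with k
  · simp [Matrix.row]
  · rfl

/-- Nonnegativity passes to the limit from the entries of `A ^ k`; a positive power `A ^ N` fixing
`π` then spreads one positive coordinate to all of them. -/
theorem IsRowWeights.leftEigvec_pos (hA : IsRowWeights G A) (hG : StronglyConnected G)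
    (hn : 0 < n) {π : Fin n → ℝ} (hπ : IsLeftEigvec A π) (i : Fin n) : 0 < π i := by
  have hnn : ∀ j, 0 ≤ π j := fun j => by
    have h := tendsto_pi_nhds.1 (tendsto_pi_nhds.1 (hA.tendsto_pow hG hn hπ) i) j
    exact ge_of_tendsto' h fun k => hA.pow_nonneg k i j
  obtain ⟨N, hN⟩ := hA.exists_pow_pos hG
  obtain ⟨j, hj⟩ : ∃ j, 0 < π j := by
    by_contra! hcon
    have := hπ.2
    rw [Finset.sum_eq_zero fun j _ => le_antisymm (hcon j) (hnn j)] at this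
    norm_num at this
  rw [← hπ.vecMul_pow N]
  exact Finset.sum_pos' (fun l _ => mul_nonneg (hnn l) (hN l i).le)
    ⟨j, Finset.mem_univ j, mul_pos hj (hN j i)⟩

/-! ### Column-stochastic weights -/

/-- The digraph with all edges reversed. -/
def reversed (G : Digraph (Fin n)) : Digraph (Fin n) := ⟨fun u v => G.Adj v u⟩

theorem StronglyConnected.reversed (hG : StronglyConnected G) :
    StronglyConnected (reversed G) := fun u v => (hG v u).swap

theorem IsColWeights.transpose (hB : IsColWeights G B) : IsRowWeights (reversed G) Bᵀ :=
  ⟨fun i j h => hB.pos j i h, fun i j h => hB.zero j i h, hB.col_sum⟩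

theorem isRightEigvec_iff {π : Fin n → ℝ} : IsRightEigvec B π ↔ IsLeftEigvec Bᵀ π := by
  rw [IsRightEigvec, IsLeftEigvec, Matrix.vecMul_transpose]

theorem IsColWeights.tendsto_pow (hB : IsColWeights G B) (hG : StronglyConnected G)
    (hn : 0 < n) {π : Fin n → ℝ} (hπ : IsRightEigvec B π) :
    Tendsto (fun k : ℕ => B ^ k) atTop (𝓝 (Matrix.of fun i _ => π i)) := by
  have h := hB.transpose.tendsto_pow hG.reversed hn (isRightEigvec_iff.1 hπ)
  refine tendsto_pi_nhds.2 fun i => tendsto_pi_nhds.2 fun j => ?_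
  have h2 := tendsto_pi_nhds.1 (tendsto_pi_nhds.1 h j) i
  simpa only [← Matrix.transpose_pow, Matrix.transpose_apply, Matrix.of_apply] using h2

end Stochastic

/-! ### Contraction norms -/

section Operators

variable {n p : ℕ}

theorem toOp_mul (X Y : BigMatrix n p) : toOp (X * Y) = toOp X * toOp Y := map_mul _ _ _

theorem toOp_sub (X Y : BigMatrix n p) : toOp (X - Y) = toOp X - toOp Y := map_sub _ _ _

theorem toOp_one : toOp (1 : BigMatrix n p) = 1 := map_one _

theorem toOp_pow (X : BigMatrix n p) (k : ℕ) : toOp (X ^ k) = toOp X ^ k := map_pow _ _ _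

theorem toOp_zero : toOp (0 : BigMatrix n p) = 0 := map_zero _

theorem toOp_eq_zero_iff {X : BigMatrix n p} : toOp X = 0 ↔ X = 0 :=
  EmbeddingLike.map_eq_zero_iff

theorem specNorm_nonneg (X : BigMatrix n p) : 0 ≤ specNorm X := norm_nonneg _

theorem specNorm_pos {X : BigMatrix n p} (hX : X ≠ 0) : 0 < specNorm X :=
  norm_pos_iff.2 (mt toOp_eq_zero_iff.1 hX)

theorem norm_toOp_le (X : BigMatrix n p) (v : StackedVec n p) : ‖toOp X v‖ ≤ specNorm X * ‖v‖ :=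
  (toOp X).le_opNorm v

theorem continuous_toOp : Continuous (toOp : BigMatrix n p → _) :=
  (Matrix.toEuclideanCLM (n := Fin n × Fin p) (𝕜 := ℝ)).toAlgEquiv.toLinearMap
    |>.continuous_of_finiteDimensional

/-- `P` is the limit of the powers of `X`. -/
abbrev PowLimit (X P : BigMatrix n p) : Prop := Tendsto (fun k : ℕ => X ^ k) atTop (𝓝 P)

variable {X P : BigMatrix n p}

theorem PowLimit.infPow_eq (h : PowLimit X P) : infPow X = P := h.limUnder_eq

theorem PowLimit.mul_left (h : PowLimit X P) : X * P = P := by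
  refine tendsto_nhds_unique (h.const_mul X) ?_
  simpa only [← pow_succ'] using (tendsto_add_atTop_iff_nat 1).2 h

theorem PowLimit.mul_right (h : PowLimit X P) : P * X = P := by
  refine tendsto_nhds_unique (h.mul_const X) ?_
  simpa only [← pow_succ] using (tendsto_add_atTop_iff_nat 1).2 h

theorem PowLimit.mul_self (h : PowLimit X P) : P * P = P := by
  refine tendsto_nhds_unique (h.mul_const P) ?_
  have : ∀ k : ℕ, X ^ k * P = P := by
    intro k
    induction k with
    | zero => simp
    | succ k ih => rw [pow_succ, mul_assoc, h.mul_left, ih]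
  simp only [this]
  exact tendsto_const_nhds

/-- The limit `P` is idempotent and absorbs `X` on both sides, so all cross terms collapse. The
exponent is shifted because the identity can fail at exponent `0`. -/
theorem PowLimit.sub_pow (h : PowLimit X P) (k : ℕ) : (X - P) ^ (k + 1) = X ^ (k + 1) - P := by
  induction k with
  | zero => simp
  | succ k ih =>
    have hP : X ^ (k + 1) * P = P := by
      rw [pow_succ, mul_assoc, h.mul_left]
      clear ih
      induction k with
      | zero => simp
      | succ k ih => rw [pow_succ, mul_assoc, h.mul_left, ih]
    rw [pow_succ, ih, sub_mul, mul_sub, mul_sub, ← pow_succ, hP, h.mul_right, h.mul_self]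
    abel

/-- The sum `∑_{j < N} ‖M ^ j v‖ / σ ^ j`. -/
noncomputable def weightedOrbitSeminorm (M : StackedVec n p →L[ℝ] StackedVec n p) (σ : ℝ)
    (hσ : 0 < σ) (N : ℕ) : Seminorm ℝ (StackedVec n p) :=
  Seminorm.of (fun v => ∑ j ∈ Finset.range N, σ⁻¹ ^ j * ‖(M ^ j) v‖)
    (fun v w => by
      rw [← Finset.sum_add_distrib]
      refine Finset.sum_le_sum fun j _ => ?_
      rw [map_add, ← mul_add]
      gcongr
      exact norm_add_le _ _)
    (fun c v => by
      rw [Finset.mul_sum]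
      refine Finset.sum_congr rfl fun j _ => ?_
      rw [map_smul, norm_smul]
      ring)

theorem weightedOrbitSeminorm_apply (M : StackedVec n p →L[ℝ] StackedVec n p) (σ : ℝ)
    (hσ : 0 < σ) (N : ℕ) (v : StackedVec n p) :
    weightedOrbitSeminorm M σ hσ N v = ∑ j ∈ Finset.range N, σ⁻¹ ^ j * ‖(M ^ j) v‖ := rfl

/-- A high power of `M = X - P` is small, so `‖M ^ (k + 1)‖ ≤ σ ^ (k + 1)` for some `σ < 1`. In the
weighted sum over the orbit segment `v, M v, …, M ^ k v`, applying `M` shifts the terms and produces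
a factor `σ`; the new last term is at most the dropped first term `‖v‖`. -/
theorem PowLimit.exists_contractionNorm (h : PowLimit X P) :
    ∃ (S : Seminorm ℝ (StackedVec n p)) (σ C : ℝ), IsContractionNorm X S σ ∧ 0 < C ∧
      (∀ v, ‖v‖ ≤ S v) ∧ ∀ v, S v ≤ C * ‖v‖ := by
  set M := toOp (X - P) with hM
  have hlim : Tendsto (fun k : ℕ => ‖M ^ (k + 1)‖) atTop (𝓝 0) := by
    have h1 := ((tendsto_add_atTop_iff_nat 1).2 h).sub_const P
    rw [sub_self] at h1
    have h2 := (continuous_toOp.tendsto 0).comp h1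
    rw [toOp_zero] at h2
    have h3 := h2.norm
    rw [norm_zero] at h3
    refine h3.congr fun k => ?_
    rw [Function.comp_apply, ← h.sub_pow, toOp_pow]
  obtain ⟨k, hk⟩ := ((tendsto_order.1 hlim).2 (1 / 2) (by norm_num)).exists
  -- Any `σ < 1` so close to `1` that `σ ^ (k + 1) > 1 / 2` will do.
  obtain ⟨σ, hσ0, hσ1, hσ⟩ : ∃ σ : ℝ, 0 < σ ∧ σ < 1 ∧ ‖M ^ (k + 1)‖ ≤ σ ^ (k + 1) := by
    have hcont : Tendsto (fun s : ℝ => s ^ (k + 1)) (𝓝[<] 1) (𝓝 1) := by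
      have : ContinuousAt (fun s : ℝ => s ^ (k + 1)) 1 := by fun_prop
      simpa using this.tendsto.mono_left nhdsWithin_le_nhds
    have h1 := (tendsto_order.1 hcont).1 (1 / 2) (by norm_num)
    have h2 : ∀ᶠ s : ℝ in 𝓝[<] 1, 0 < s :=
      nhdsWithin_le_nhds (lt_mem_nhds (by norm_num))
    obtain ⟨s, ⟨hs1, hs2⟩, hs3⟩ := ((h1.and h2).and self_mem_nhdsWithin).exists
    exact ⟨s, hs2, hs3, (hk.trans hs1).le⟩
  set S := weightedOrbitSeminorm M σ hσ0 (k + 1) with hS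
  have hge : ∀ v, ‖v‖ ≤ S v := fun v => by
    rw [hS, weightedOrbitSeminorm_apply, Finset.sum_range_succ']
    have : 0 ≤ ∑ j ∈ Finset.range k, σ⁻¹ ^ (j + 1) * ‖(M ^ (j + 1)) v‖ := by positivity
    simpa using this
  -- The summand `1` keeps the constant positive even on the zero space, where all operator norms
  -- vanish.
  refine ⟨S, σ, (∑ j ∈ Finset.range (k + 1), σ⁻¹ ^ j * ‖M ^ j‖) + 1,
    ⟨fun v hv => ?_, hσ0, hσ1, fun v => ?_⟩, by positivity, hge, fun v => ?_⟩
  · have := hge v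
    rw [hv] at this
    exact norm_le_zero_iff.1 this
  · rw [h.infPow_eq, ← hM]
    have hlast : σ⁻¹ ^ (k + 1) * ‖(M ^ (k + 1)) v‖ ≤ ‖v‖ := by
      calc σ⁻¹ ^ (k + 1) * ‖(M ^ (k + 1)) v‖ ≤ σ⁻¹ ^ (k + 1) * (σ ^ (k + 1) * ‖v‖) := by
            gcongr
            exact ((M ^ (k + 1)).le_opNorm v).trans (by gcongr)
        _ = ‖v‖ := by
            rw [← mul_assoc, ← mul_pow, inv_mul_cancel₀ hσ0.ne', one_pow, one_mul]
    have hshift : S (M v) = σ * ∑ j ∈ Finset.range (k + 1), σ⁻¹ ^ (j + 1) * ‖(M ^ (j + 1)) v‖ := by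
      rw [hS, weightedOrbitSeminorm_apply, Finset.mul_sum]
      refine Finset.sum_congr rfl fun j _ => ?_
      rw [pow_succ M, pow_succ σ⁻¹]
      field_simp
      rfl
    rw [hshift]
    gcongr
    rw [Finset.sum_range_succ, hS, weightedOrbitSeminorm_apply, Finset.sum_range_succ']
    simpa using hlast
  · rw [hS, weightedOrbitSeminorm_apply, add_mul, Finset.sum_mul]
    have : ∑ j ∈ Finset.range (k + 1), σ⁻¹ ^ j * ‖(M ^ j) v‖ ≤
        ∑ j ∈ Finset.range (k + 1), σ⁻¹ ^ j * ‖M ^ j‖ * ‖v‖ := by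
      refine Finset.sum_le_sum fun j _ => ?_
      rw [mul_assoc]
      gcongr
      exact (M ^ j).le_opNorm v
    linarith [norm_nonneg v]

/-! ### Kronecker products with the identity -/

theorem kronI_pow (A : Matrix (Fin n) (Fin n) ℝ) (k : ℕ) : kronI p A ^ k = kronI p (A ^ k) := by
  induction k with
  | zero => simp [kronI]
  | succ k ih => rw [pow_succ, ih, pow_succ, kronI, kronI, kronI, ← Matrix.mul_kronecker_mul,
      one_mul]

theorem powLimit_kronI {A A' : Matrix (Fin n) (Fin n) ℝ}
    (h : Tendsto (fun k : ℕ => A ^ k) atTop (𝓝 A')) : PowLimit (kronI p A) (kronI p A') := by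
  rw [PowLimit]
  simp only [kronI_pow]
  refine tendsto_pi_nhds.2 fun i => tendsto_pi_nhds.2 fun j => ?_
  simp only [kronI, Matrix.kroneckerMap_apply]
  exact (tendsto_pi_nhds.1 (tendsto_pi_nhds.1 h i.1) j.1).mul_const _

theorem kronI_apply_same (A : Matrix (Fin n) (Fin n) ℝ) (i j : Fin n) (c : Fin p) :
    kronI p A (i, c) (j, c) = A i j := by
  simp [kronI]

theorem toOp_kronI_stack (A : Matrix (Fin n) (Fin n) ℝ) (v : Fin n → Vec p) :
    toOp (kronI p A) (stack v) = stack fun i => ∑ j, A i j • v j := by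
  ext ⟨i, c⟩
  rw [toOp, stack, Matrix.toEuclideanCLM_toLp, stack]
  simp [Matrix.mulVec, dotProduct, kronI, Fintype.sum_prod_type, Matrix.one_apply]

theorem stack_sub (v w : Fin n → Vec p) : stack (fun i => v i - w i) = stack v - stack w := rfl

theorem stack_add (v w : Fin n → Vec p) : stack (fun i => v i + w i) = stack v + stack w := rfl

theorem stack_smul (c : ℝ) (v : Fin n → Vec p) : stack (fun i => c • v i) = c • stack v := rfl

theorem norm_stack_sq (v : Fin n → Vec p) : ‖stack v‖ ^ 2 = ∑ i, ‖v i‖ ^ 2 := by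
  simp [EuclideanSpace.norm_sq_eq, stack, Fintype.sum_prod_type]

theorem norm_stack_le {v w : Fin n → Vec p} {c : ℝ} (hc : 0 ≤ c)
    (h : ∀ i, ‖v i‖ ≤ c * ‖w i‖) : ‖stack v‖ ≤ c * ‖stack w‖ := by
  refine le_of_sq_le_sq ?_ (by positivity)
  rw [mul_pow, norm_stack_sq, norm_stack_sq, Finset.mul_sum]
  refine Finset.sum_le_sum fun i _ => ?_
  rw [← mul_pow]
  exact pow_le_pow_left₀ (norm_nonneg _) (h i) 2

theorem norm_stack_const (u : Vec p) : ‖stack (n := n) fun _ => u‖ = √n * ‖u‖ := by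
  refine (sq_eq_sq₀ (norm_nonneg _) (by positivity)).1 ?_
  rw [norm_stack_sq, mul_pow, Real.sq_sqrt (by positivity)]
  simp

theorem sum_norm_le_norm_stack (v : Fin n → Vec p) : ∑ i, ‖v i‖ ≤ √n * ‖stack v‖ := by
  refine le_of_sq_le_sq ?_ (by positivity)
  rw [mul_pow, Real.sq_sqrt (by positivity), norm_stack_sq]
  simpa using sq_sum_le_card_mul_sum_sq (s := Finset.univ) (f := fun i => ‖v i‖)

end Operators

/-! ### Smooth strongly convex functions -/

section Convex

variable {E : Type*} [NormedAddCommGroup E] [InnerProductSpace ℝ E] [CompleteSpace E]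
  {f : E → ℝ} {α β : ℝ}

/-- The quadratic upper bound for a function with Lipschitz gradient. -/
theorem le_quadratic_of_lipschitz_gradient (hf : Differentiable ℝ f)
    (hlip : ∀ z w, ‖∇ f z - ∇ f w‖ ≤ β * ‖z - w‖) (z d : E) :
    f (z + d) ≤ f z + inner ℝ (∇ f z) d + β / 2 * ‖d‖ ^ 2 := by
  have hder : ∀ t : ℝ, HasDerivAt
      (fun t : ℝ => f (z + t • d) - t * inner ℝ (∇ f z) d - β / 2 * ‖d‖ ^ 2 * t ^ 2)
      (inner ℝ (∇ f (z + t • d)) d - inner ℝ (∇ f z) d - β * ‖d‖ ^ 2 * t) t := by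
    intro t
    have h1 : HasDerivAt (fun t : ℝ => z + t • d) d t := by
      simpa using ((hasDerivAt_id t).smul_const d).const_add z
    have h2 := (hf (z + t • d)).hasGradientAt.hasFDerivAt.comp_hasDerivAt t h1
    rw [InnerProductSpace.toDual_apply_apply] at h2
    have h3 := (h2.sub ((hasDerivAt_id t).mul_const (inner ℝ (∇ f z) d))).sub
      (((hasDerivAt_id t).pow 2).const_mul (β / 2 * ‖d‖ ^ 2))
    refine h3.congr_deriv ?_
    simp
    ring
  -- By the Lipschitz bound and Cauchy–Schwarz the derivative is nonpositive for `t > 0`; comparing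
  -- `t = 0` with `t = 1` gives the claim.
  have hanti : AntitoneOn
      (fun t : ℝ => f (z + t • d) - t * inner ℝ (∇ f z) d - β / 2 * ‖d‖ ^ 2 * t ^ 2)
      (Set.Ici 0) := by
    refine antitoneOn_of_deriv_nonpos (convex_Ici 0)
      (fun t _ => (hder t).continuousAt.continuousWithinAt)
      (fun t _ => (hder t).differentiableAt.differentiableWithinAt) fun t ht => ?_
    rw [interior_Ici] at ht
    have ht : 0 < t := ht
    rw [(hder t).deriv, ← inner_sub_left]
    have h1 := real_inner_le_norm (∇ f (z + t • d) - ∇ f z) d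
    have h2 := hlip (z + t • d) z
    rw [add_sub_cancel_left, norm_smul, Real.norm_of_nonneg ht.le] at h2
    nlinarith [norm_nonneg d]
  have h := hanti (Set.mem_Ici.2 le_rfl) (Set.mem_Ici.2 zero_le_one) zero_le_one
  simp only [one_smul, one_mul, one_pow, mul_one, zero_smul, add_zero, zero_mul, sub_zero,
    ne_eq, OfNat.ofNat_ne_zero, not_false_eq_true, zero_pow, mul_zero] at h
  linarith

/-- One half of the co-coercivity of the gradient of `f - α / 2 * ‖·‖ ^ 2`. -/
theorem norm_gradient_sub_sq_le (hαβ : α < β) (hf : Differentiable ℝ f)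
    (hlip : ∀ z w, ‖∇ f z - ∇ f w‖ ≤ β * ‖z - w‖)
    (hconv : ∀ z w, f z - f w ≤ inner ℝ (∇ f z) (z - w) - α / 2 * ‖z - w‖ ^ 2) (x y : E) :
    1 / (2 * (β - α)) * ‖∇ f x - ∇ f y - α • (x - y)‖ ^ 2 ≤
      f y - f x - inner ℝ (∇ f x) (y - x) - α / 2 * ‖x - y‖ ^ 2 := by
  set G := ∇ f x - ∇ f y - α • (x - y) with hG
  set t := 1 / (β - α) with ht
  have hL : 0 < β - α := sub_pos.2 hαβ
  -- With `h = f - α / 2 * ‖·‖ ^ 2`, the test point `y + t • G` is a gradient step of length `1 / (β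
  -- - α)` from `y` for `h - ⟨∇h x, ·⟩`, which is minimal at `x`. The quadratic upper bound at `y`
  -- and strong convexity at `x` are compared there.
  have h1 := le_quadratic_of_lipschitz_gradient hf hlip y (t • G)
  have h2 := hconv x (y + t • G)
  have e1 : inner ℝ (∇ f x) (x - (y + t • G)) =
      inner ℝ (∇ f x) (x - y) - t * inner ℝ (∇ f x) G := by
    rw [← sub_sub, inner_sub_right, inner_smul_right]
  have e2 : ‖x - (y + t • G)‖ ^ 2 = ‖x - y‖ ^ 2 - 2 * (t * inner ℝ (x - y) G) +
      t ^ 2 * ‖G‖ ^ 2 := by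
    rw [← sub_sub, norm_sub_sq_real, inner_smul_right, norm_smul, mul_pow, Real.norm_eq_abs,
      sq_abs]
  have e3 : ‖t • G‖ ^ 2 = t ^ 2 * ‖G‖ ^ 2 := by
    rw [norm_smul, mul_pow, Real.norm_eq_abs, sq_abs]
  have e4 : ‖G‖ ^ 2 = inner ℝ (∇ f x) G - inner ℝ (∇ f y) G - α * inner ℝ (x - y) G := by
    rw [← real_inner_self_eq_norm_sq]
    nth_rw 1 [hG]
    rw [inner_sub_left, inner_sub_left, inner_smul_left]
    simp
  have e5 : inner ℝ (∇ f x) (y - x) = - inner ℝ (∇ f x) (x - y) := by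
    rw [← inner_neg_right, neg_sub]
  rw [inner_smul_right, e3] at h1
  rw [e1, e2] at h2
  rw [e5]
  have ht1 : t * (β - α) = 1 := by rw [ht]; field_simp
  have ht2 : 1 / (2 * (β - α)) = t / 2 := by rw [ht]; field_simp
  rw [ht2]
  have e6 : t ^ 2 * (β - α) = t := by rw [sq, mul_assoc, ht1, mul_one]
  have e7 : t * ‖G‖ ^ 2 = t * inner ℝ (∇ f x) G - t * inner ℝ (∇ f y) G
      - α * (t * inner ℝ (x - y) G) := by rw [e4]; ring
  have e8 : t ^ 2 * (β - α) * ‖G‖ ^ 2 = t * ‖G‖ ^ 2 := by rw [e6]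
  linarith

theorem strong_monotone
    (hconv : ∀ z w, f z - f w ≤ inner ℝ (∇ f z) (z - w) - α / 2 * ‖z - w‖ ^ 2) (x y : E) :
    α * ‖x - y‖ ^ 2 ≤ inner ℝ (∇ f x - ∇ f y) (x - y) := by
  have h1 := hconv x y
  have h2 := hconv y x
  rw [← neg_sub x y, inner_neg_right, norm_neg] at h2
  rw [inner_sub_left]
  linarith

theorem strong_convexity_le_lipschitz [Nontrivial E]
    (hlip : ∀ z w, ‖∇ f z - ∇ f w‖ ≤ β * ‖z - w‖)
    (hconv : ∀ z w, f z - f w ≤ inner ℝ (∇ f z) (z - w) - α / 2 * ‖z - w‖ ^ 2) : α ≤ β := by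
  obtain ⟨x, y, hxy⟩ := exists_pair_ne E
  have h0 : 0 < ‖x - y‖ := norm_pos_iff.2 (sub_ne_zero.2 hxy)
  have h1 := strong_monotone hconv x y
  have h2 := real_inner_le_norm (∇ f x - ∇ f y) (x - y)
  have h3 := hlip x y
  have h4 : α * ‖x - y‖ ^ 2 ≤ β * ‖x - y‖ ^ 2 := by nlinarith
  exact le_of_mul_le_mul_right h4 (by positivity)

/-- The gradient difference lies in the ball with diameter from `α • (x - y)` to
`β • (x - y)`. -/
theorem inner_gradient_sub_nonpos
    (hf : Differentiable ℝ f) (hlip : ∀ z w, ‖∇ f z - ∇ f w‖ ≤ β * ‖z - w‖)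
    (hconv : ∀ z w, f z - f w ≤ inner ℝ (∇ f z) (z - w) - α / 2 * ‖z - w‖ ^ 2) (x y : E) :
    ‖∇ f x - ∇ f y‖ ^ 2 - (α + β) * inner ℝ (∇ f x - ∇ f y) (x - y) +
      α * β * ‖x - y‖ ^ 2 ≤ 0 := by
  rcases subsingleton_or_nontrivial E with _ | _
  · simp [Subsingleton.elim x y]
  have hmon := strong_monotone hconv x y
  rcases (strong_convexity_le_lipschitz hlip hconv).eq_or_lt with rfl | hαβ
  · have h3 := hlip x y
    have h0 : 0 ≤ α := by
      by_contra! h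
      obtain ⟨u, v, huv⟩ := exists_pair_ne E
      have h0 : 0 < ‖u - v‖ := norm_pos_iff.2 (sub_ne_zero.2 huv)
      nlinarith [hlip u v, norm_nonneg (∇ f u - ∇ f v)]
    have h4 : ‖∇ f x - ∇ f y‖ ^ 2 ≤ (α * ‖x - y‖) ^ 2 := pow_le_pow_left₀ (norm_nonneg _) h3 2
    nlinarith
  -- Adding the estimate to its mirror image cancels the function values. The case `α = β` is
  -- separate because of the factor `1 / (β - α)`.
  · have h1 := norm_gradient_sub_sq_le hαβ hf hlip hconv x y
    have h2 := norm_gradient_sub_sq_le hαβ hf hlip hconv y x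
    have hL : 0 < β - α := sub_pos.2 hαβ
    have e1 : ‖∇ f y - ∇ f x - α • (y - x)‖ ^ 2 = ‖∇ f x - ∇ f y - α • (x - y)‖ ^ 2 := by
      rw [← norm_neg]
      congr 2
      module
    have e2 : ‖∇ f x - ∇ f y - α • (x - y)‖ ^ 2 = ‖∇ f x - ∇ f y‖ ^ 2 -
        2 * (α * inner ℝ (∇ f x - ∇ f y) (x - y)) + α ^ 2 * ‖x - y‖ ^ 2 := by
      rw [norm_sub_sq_real, inner_smul_right, norm_smul, mul_pow, Real.norm_eq_abs, sq_abs]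
    have e3 : inner ℝ (∇ f x) (y - x) = - inner ℝ (∇ f x) (x - y) := by
      rw [← inner_neg_right, neg_sub]
    have e4 : inner ℝ (∇ f x - ∇ f y) (x - y) =
      inner ℝ (∇ f x) (x - y) - inner ℝ (∇ f y) (x - y) := inner_sub_left _ _ _
    rw [e1, norm_sub_rev y x] at h2
    rw [e3] at h1
    set Q := ‖∇ f x - ∇ f y - α • (x - y)‖ ^ 2
    have h5 : 1 / (2 * (β - α)) * Q + 1 / (2 * (β - α)) * Q ≤
        inner ℝ (∇ f x - ∇ f y) (x - y) - α * ‖x - y‖ ^ 2 := by rw [e4]; linarith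
    have h6 : Q ≤ (β - α) * (inner ℝ (∇ f x - ∇ f y) (x - y) - α * ‖x - y‖ ^ 2) := by
      calc Q = (β - α) * (1 / (2 * (β - α)) * Q + 1 / (2 * (β - α)) * Q) := by field_simp; ring
        _ ≤ _ := mul_le_mul_of_nonneg_left h5 hL.le
    rw [e2] at h6
    nlinarith

/-- With `d = x - y`, the gradient difference lies in the ball of centre `((α + β) / 2) d` and
radius `((β - α) / 2) ‖d‖`. Its image under `g ↦ d - γ g` is a ball centred on the line through `d`,
whose points of largest norm are among the images of `α d` and `β d`. -/
theorem norm_gradient_step_le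
    (hf : Differentiable ℝ f) (hlip : ∀ z w, ‖∇ f z - ∇ f w‖ ≤ β * ‖z - w‖)
    (hconv : ∀ z w, f z - f w ≤ inner ℝ (∇ f z) (z - w) - α / 2 * ‖z - w‖ ^ 2)
    (γ : ℝ) (x y : E) :
    ‖x - y - γ • (∇ f x - ∇ f y)‖ ≤ max |1 - α * γ| |1 - β * γ| * ‖x - y‖ := by
  rcases subsingleton_or_nontrivial E with _ | _
  · simp [Subsingleton.elim x y]
  have hαβ := strong_convexity_le_lipschitz hlip hconv
  set g := ∇ f x - ∇ f y
  set d := x - y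
  have h1 : ‖g - ((α + β) / 2) • d‖ ≤ (β - α) / 2 * ‖d‖ := by
    refine le_of_sq_le_sq ?_ (by have := sub_nonneg.2 hαβ; positivity)
    rw [norm_sub_sq_real, inner_smul_right, norm_smul, mul_pow, mul_pow, Real.norm_eq_abs, sq_abs]
    -- Completing the square turns this inequality into membership in the ball.
    have := inner_gradient_sub_nonpos hf hlip hconv x y
    nlinarith
  have e : d - γ • g = (1 - γ * ((α + β) / 2)) • d - γ • (g - ((α + β) / 2) • d) := by module
  have h2 : |1 - γ * ((α + β) / 2)| + |γ| * ((β - α) / 2) ≤ max |1 - α * γ| |1 - β * γ| := by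
    rcases abs_cases (1 - γ * ((α + β) / 2)) with ⟨h, _⟩ | ⟨h, _⟩ <;>
      rcases abs_cases γ with ⟨h', _⟩ | ⟨h', _⟩ <;> rw [h, h']
    · exact le_max_of_le_left (le_trans (by linarith) (le_abs_self _))
    · exact le_max_of_le_right (le_trans (by linarith) (le_abs_self _))
    · exact le_max_of_le_right (le_trans (by linarith) (neg_le_abs _))
    · exact le_max_of_le_left (le_trans (by linarith) (neg_le_abs _))
  calc ‖d - γ • g‖ ≤ ‖(1 - γ * ((α + β) / 2)) • d‖ + ‖γ • (g - ((α + β) / 2) • d)‖ := by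
        rw [e]; exact norm_sub_le _ _
    _ = |1 - γ * ((α + β) / 2)| * ‖d‖ + |γ| * ‖g - ((α + β) / 2) • d‖ := by
        rw [norm_smul, norm_smul, Real.norm_eq_abs, Real.norm_eq_abs]
    _ ≤ |1 - γ * ((α + β) / 2)| * ‖d‖ + |γ| * ((β - α) / 2 * ‖d‖) := by gcongr
    _ = (|1 - γ * ((α + β) / 2)| + |γ| * ((β - α) / 2)) * ‖d‖ := by ring
    _ ≤ _ := by gcongr

end Convex

/-! ### The minimizer of the average -/

section Minimizer

variable {n p : ℕ} {f : Fin n → Vec p → ℝ} {α β : ℝ} {z : Vec p}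

theorem IsAdmissible.sum_gradient_eq_zero (hf : IsAdmissible f α β) (hn : 0 < n)
    (hz : IsOptimal f z) : ∑ i, ∇ (f i) z = 0 := by
  have hn' : (0 : ℝ) < 1 / n := by positivity
  have hmin : IsLocalMin (fun w => ∑ i, f i w) z :=
    Eventually.of_forall fun w => le_of_mul_le_mul_left (hz w) hn'
  have hder : HasFDerivAt (fun w => ∑ i, f i w)
      (∑ i, InnerProductSpace.toDual ℝ (Vec p) (∇ (f i) z)) z :=
    HasFDerivAt.fun_sum fun i _ => (hf.differentiable i z).hasGradientAt.hasFDerivAt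
  have h := hmin.hasFDerivAt_eq_zero hder
  rw [← map_sum] at h
  exact (InnerProductSpace.toDual ℝ (Vec p)).map_eq_zero_iff.1 h

theorem IsAdmissible.existsUnique_isOptimal (hf : IsAdmissible f α β) (hn : 0 < n) :
    ∃! z, IsOptimal f z := by
  have hn' : (0 : ℝ) < 1 / n := by positivity
  have hnp : (0 : ℝ) < n := by positivity
  have hα := hf.alpha_pos
  have hlow : ∀ z w, ∑ i, f i z + inner ℝ (∑ i, ∇ (f i) z) (w - z) +
      n * (α / 2) * ‖w - z‖ ^ 2 ≤ ∑ i, f i w := by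
    intro z w
    have h := Finset.sum_le_sum fun i (_ : i ∈ Finset.univ) => hf.strongly_convex i z w
    rw [Finset.sum_sub_distrib, Finset.sum_sub_distrib, ← sum_inner, ← neg_sub w z,
      inner_neg_right, norm_neg] at h
    simp at h
    linarith
  -- Strong convexity at `0` bounds the sum from below by a quadratic in `‖w‖` with positive leading
  -- coefficient.
  have hcoer : Tendsto (fun w => ∑ i, f i w) (cocompact (Vec p)) atTop := by
    set c := ‖∑ i, ∇ (f i) 0‖
    have hq : Tendsto (fun t : ℝ => ∑ i, f i 0 + t * (n * (α / 2) * t - c)) atTop atTop := by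
      refine tendsto_atTop_add_const_left _ _ (tendsto_id.atTop_mul_atTop₀ ?_)
      exact tendsto_atTop_add_const_right _ _ (tendsto_id.const_mul_atTop (by positivity))
    refine tendsto_atTop_mono (fun w => ?_) (hq.comp (tendsto_norm_cocompact_atTop (E := Vec p)))
    have h1 := hlow 0 w
    have h2 := neg_le_of_abs_le (abs_real_inner_le_norm (∑ i, ∇ (f i) 0) w)
    rw [sub_zero] at h1
    simp only [Function.comp_apply]
    nlinarith
  have hcont : Continuous fun w => ∑ i, f i w :=
    continuous_finsetSum _ fun i _ => (hf.differentiable i).continuous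
  obtain ⟨z, hz⟩ := hcont.exists_forall_le hcoer
  refine ⟨z, fun w => mul_le_mul_of_nonneg_left (hz w) hn'.le, fun w hw => ?_⟩
  have h1 := hlow w z
  rw [hf.sum_gradient_eq_zero hn hw, inner_zero_left] at h1
  have h2 := hz w
  have h3 : ‖z - w‖ ^ 2 ≤ 0 := by
    have : n * (α / 2) * ‖z - w‖ ^ 2 ≤ 0 := by linarith
    by_contra! hc
    have := mul_pos (mul_pos hnp (half_pos hα)) hc
    linarith
  have h4 : ‖z - w‖ = 0 := by
    have := le_antisymm h3 (sq_nonneg _)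
    simpa using this
  exact (sub_eq_zero.1 (norm_eq_zero.1 h4)).symm

theorem IsAdmissible.alpha_le_beta (hf : IsAdmissible f α β) (hn : 0 < n) (hp : 0 < p) :
    α ≤ β := by
  have : Nonempty (Fin p) := ⟨⟨0, hp⟩⟩
  exact strong_convexity_le_lipschitz (hf.lipschitz ⟨0, hn⟩) (hf.strongly_convex ⟨0, hn⟩)

theorem IsAdmissible.norm_average_step_le (hf : IsAdmissible f α β) (hn : 0 < n)
    (hz : IsOptimal f z) (γ : ℝ) (x : Vec p) :
    ‖x - z - γ • ∑ i, ∇ (f i) x‖ ≤ max |1 - α * (n * γ)| |1 - β * (n * γ)| * ‖x - z‖ := by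
  have hnp : (0 : ℝ) < n := by positivity
  -- The local gradients at `z` sum to zero, so the step is the average of `n` local steps of size
  -- `n * γ`, each contracting by the same factor.
  have e : x - z - γ • ∑ i, ∇ (f i) x =
      (1 / n : ℝ) • ∑ i, (x - z - (n * γ) • (∇ (f i) x - ∇ (f i) z)) := by
    rw [Finset.sum_sub_distrib, ← Finset.smul_sum, Finset.sum_sub_distrib, Finset.sum_sub_distrib,
      hf.sum_gradient_eq_zero hn hz]
    simp only [Finset.sum_const, Finset.card_univ, Fintype.card_fin, ← Nat.cast_smul_eq_nsmul ℝ,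
      sub_zero, smul_sub (1 / n : ℝ), smul_smul]
    congr 2 <;> field_simp <;> rw [one_smul]
  rw [e, norm_smul, Real.norm_of_nonneg (by positivity)]
  calc (1 / n : ℝ) * ‖∑ i, (x - z - (n * γ) • (∇ (f i) x - ∇ (f i) z))‖
      ≤ (1 / n : ℝ) * ∑ _i : Fin n, max |1 - α * (n * γ)| |1 - β * (n * γ)| * ‖x - z‖ := by
        gcongr
        refine (norm_sum_le _ _).trans (Finset.sum_le_sum fun i _ => ?_)
        exact norm_gradient_step_le (hf.differentiable i) (hf.lipschitz i)
          (hf.strongly_convex i) _ _ _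
    _ = _ := by
        simp only [Finset.sum_const, Finset.card_univ, Fintype.card_fin, nsmul_eq_mul]
        field_simp

end Minimizer

/-! ### Positive matrices -/

section Positive

variable {ι : Type*} [Fintype ι]

theorem mulVec_mono {J : Matrix ι ι ℝ} (hJ : ∀ i j, 0 ≤ J i j) {v w : ι → ℝ} (h : v ≤ w) :
    J *ᵥ v ≤ J *ᵥ w := fun i =>
  Finset.sum_le_sum fun j _ => mul_le_mul_of_nonneg_left (h j) (hJ i j)

theorem mulVec_pos {J : Matrix ι ι ℝ} (hJ : ∀ i j, 0 < J i j) {v : ι → ℝ} (hv : 0 ≤ v)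
    (hv0 : v ≠ 0) (i : ι) : 0 < (J *ᵥ v) i := by
  obtain ⟨j, hj⟩ := Function.ne_iff.1 hv0
  exact Finset.sum_pos' (fun l _ => mul_nonneg (hJ i l).le (hv l))
    ⟨j, Finset.mem_univ j, mul_pos (hJ i j) ((hv j).lt_of_ne' hj)⟩

theorem exists_lt_mulVec_le [Nonempty ι] {J : Matrix ι ι ℝ} {w : ι → ℝ} {r : ℝ}
    (hw : ∀ i, 0 < w i) (h : ∀ i, (J *ᵥ w) i < r * w i) :
    ∃ s < r, ∀ i, (J *ᵥ w) i ≤ s * w i := by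
  obtain ⟨i, hi⟩ := Finite.exists_max fun i => (J *ᵥ w) i / w i
  exact ⟨(J *ᵥ w) i / w i, (div_lt_iff₀ (hw i)).2 (h i),
    fun j => (div_le_iff₀ (hw j)).1 (hi j)⟩

/-- The existence part of Perron's theorem. -/
theorem exists_pos_eigenvector [Nonempty ι] {J : Matrix ι ι ℝ} (hJ : ∀ i j, 0 < J i j) :
    ∃ (r : ℝ) (v : ι → ℝ), 0 < r ∧ (∀ i, 0 < v i) ∧ J *ᵥ v = r • v := by
  -- The largest row sum `c` bounds the candidate values of `r`, for compactness, and is itself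
  -- attained by the uniform vector, for nonemptiness.
  obtain ⟨c, hc0, hc⟩ : ∃ c : ℝ, 0 ≤ c ∧ ∀ i, (J *ᵥ 1) i ≤ c := by
    obtain ⟨i, hi⟩ := Finite.exists_max (J *ᵥ 1)
    exact ⟨_, Finset.sum_nonneg fun j _ => mul_nonneg (hJ i j).le zero_le_one, hi⟩
  set S : Set (ℝ × (ι → ℝ)) :=
    {x | 0 ≤ x.1 ∧ x.1 ≤ c ∧ x.2 ∈ stdSimplex ℝ ι ∧ J *ᵥ x.2 ≤ x.1 • x.2} with hS
  have hcomp : IsCompact S := by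
    refine (isCompact_Icc (a := (0 : ℝ)) (b := c)).prod (isCompact_stdSimplex ℝ ι)
      |>.of_isClosed_subset ?_ fun x hx => ⟨⟨hx.1, hx.2.1⟩, hx.2.2.1⟩
    have h1 : IsClosed {x : ℝ × (ι → ℝ) | 0 ≤ x.1} := isClosed_le (by fun_prop) (by fun_prop)
    have h2 : IsClosed {x : ℝ × (ι → ℝ) | x.1 ≤ c} := isClosed_le (by fun_prop) (by fun_prop)
    have h3 : IsClosed {x : ℝ × (ι → ℝ) | x.2 ∈ stdSimplex ℝ ι} :=
      (isClosed_stdSimplex ℝ ι).preimage continuous_snd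
    have h4 : IsClosed {x : ℝ × (ι → ℝ) | J *ᵥ x.2 ≤ x.1 • x.2} :=
      isClosed_le (by fun_prop) (by fun_prop)
    exact h1.inter (h2.inter (h3.inter h4))
  have hcard : (0 : ℝ) < Fintype.card ι := by exact_mod_cast Fintype.card_pos
  have hne : S.Nonempty := by
    refine ⟨(c, (Fintype.card ι : ℝ)⁻¹ • 1), hc0, le_rfl, ⟨fun i => ?_, ?_⟩, fun i => ?_⟩
    · simp
    · simp
    · rw [Matrix.mulVec_smul]
      have := mul_le_mul_of_nonneg_left (hc i) (inv_nonneg.2 hcard.le)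
      simpa [mul_comm] using this
  obtain ⟨⟨r, w⟩, ⟨hr0, hrc, ⟨hw0, hw1⟩, hJw⟩, hmin⟩ :=
    hcomp.exists_isMinOn hne continuous_fst.continuousOn
  have hwne : w ≠ 0 := by
    rintro rfl
    simp at hw1
  have hJpos := mulVec_pos hJ hw0 hwne
  have hwpos : ∀ i, 0 < w i := fun i => (hw0 i).lt_of_ne fun h => by
    have h1 : 0 < r * w i := (hJpos i).trans_le (hJw i)
    have h2 : 0 = w i := h
    rw [← h2, mul_zero] at h1
    exact h1.false
  have hr : 0 < r := by
    obtain ⟨i⟩ := ‹Nonempty ι›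
    have : 0 < r * w i := (hJpos i).trans_le (hJw i)
    exact pos_of_mul_pos_left this (hw0 i)
  refine ⟨r, w, hr, hwpos, ?_⟩
  by_contra hcon
  have hd : ∀ i, 0 < (J *ᵥ (r • w - J *ᵥ w)) i :=
    mulVec_pos hJ (sub_nonneg.2 hJw) (sub_ne_zero.2 (Ne.symm hcon))
  -- If `J w ≠ r w`, then `J` maps the nonzero nonnegative slack to a positive vector, so `J w`,
  -- once normalised, admits some `s < r`, against minimality.
  obtain ⟨s, hsr, hs⟩ := exists_lt_mulVec_le (J := J) (w := J *ᵥ w) (r := r) hJpos fun i => by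
    have := hd i
    rw [Matrix.mulVec_sub, Matrix.mulVec_smul] at this
    simpa using this
  have hs0 : 0 ≤ s := by
    obtain ⟨i⟩ := ‹Nonempty ι›
    have h1 := mulVec_pos hJ (fun i => (hJpos i).le)
      (Function.ne_iff.2 ⟨i, (hJpos i).ne'⟩) i
    exact (pos_of_mul_pos_left (h1.trans_le (hs i)) (hJpos i).le).le
  set T := ∑ i, (J *ᵥ w) i with hT
  have hT0 : 0 < T := Finset.sum_pos (fun i _ => hJpos i) Finset.univ_nonempty
  have hmem : (s, T⁻¹ • (J *ᵥ w)) ∈ S := by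
    refine ⟨hs0, hsr.le.trans hrc, ⟨fun i => ?_, ?_⟩, fun i => ?_⟩
    · exact mul_nonneg (inv_nonneg.2 hT0.le) (hJpos i).le
    · simp only [Pi.smul_apply, smul_eq_mul, ← Finset.mul_sum]
      exact inv_mul_cancel₀ hT0.ne'
    · rw [Matrix.mulVec_smul]
      have := mul_le_mul_of_nonneg_left (hs i) (inv_nonneg.2 hT0.le)
      simp only [Pi.smul_apply, smul_eq_mul]
      linarith
  exact hsr.not_ge (hmin hmem)

theorem exists_eq_mulVec_of_mem_spectrum [DecidableEq ι] {M : Matrix ι ι ℂ} {μ : ℂ} :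
    μ ∈ spectrum ℂ M ↔ ∃ z : ι → ℂ, z ≠ 0 ∧ M *ᵥ z = μ • z := by
  rw [spectrum.mem_iff, Matrix.isUnit_iff_isUnit_det, isUnit_iff_ne_zero, not_not,
    ← Matrix.exists_mulVec_eq_zero_iff]
  refine exists_congr fun z => and_congr_right fun _ => ?_
  rw [Matrix.sub_mulVec, Algebra.algebraMap_eq_smul_one, Matrix.smul_mulVec, Matrix.one_mulVec,
    sub_eq_zero, eq_comm]

/-- In the maximum norm weighted by `w`, the matrix strictly shrinks every nonzero vector, so every
eigenvalue has modulus below `1`. -/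
theorem spectralRadius_lt_one_of_mulVec_lt [DecidableEq ι] [Nonempty ι] {J : Matrix ι ι ℝ}
    (hJ : ∀ i j, 0 ≤ J i j) {w : ι → ℝ} (hw : ∀ i, 0 < w i) (h : ∀ i, (J *ᵥ w) i < w i) :
    spectralRadius ℂ (J.map (fun r : ℝ => (r : ℂ))) < 1 := by
  -- The spectrum does not depend on this norm; a Banach algebra structure is needed only to pass
  -- from a strict bound on each eigenvalue to one on their supremum.
  let _ : NormedRing (Matrix ι ι ℂ) := Matrix.linftyOpNormedRing
  let _ : NormedAlgebra ℂ (Matrix ι ι ℂ) := Matrix.linftyOpNormedAlgebra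
  refine spectrum.spectralRadius_lt_of_forall_lt _ (r := 1) fun μ hμ => ?_
  obtain ⟨z, hz0, hz⟩ := exists_eq_mulVec_of_mem_spectrum.1 hμ
  obtain ⟨i, hi⟩ := Finite.exists_max fun i => ‖z i‖ / w i
  set M := ‖z i‖ / w i with hM
  have hle : ∀ j, ‖z j‖ ≤ M * w j := fun j => (div_le_iff₀ (hw j)).1 (hi j)
  have hM0 : 0 < M := by
    obtain ⟨j, hj⟩ := Function.ne_iff.1 hz0
    exact (div_pos (norm_pos_iff.2 hj) (hw j)).trans_le (hi j)
  have hzi : ‖z i‖ = M * w i := by rw [hM, div_mul_cancel₀ _ (hw i).ne']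
  have h1 : ‖μ‖ * ‖z i‖ < ‖z i‖ := by
    calc ‖μ‖ * ‖z i‖ = ‖∑ j, (J i j : ℂ) * z j‖ := by
          rw [← norm_mul]
          exact congrArg norm (congrFun hz i).symm
      _ ≤ ∑ j, J i j * (M * w j) := by
          refine (norm_sum_le _ _).trans (Finset.sum_le_sum fun j _ => ?_)
          rw [norm_mul, Complex.norm_of_nonneg (hJ i j)]
          exact mul_le_mul_of_nonneg_left (hle j) (hJ i j)
      _ = M * (J *ᵥ w) i := by
          simp only [Matrix.mulVec, dotProduct, Finset.mul_sum]
          exact Finset.sum_congr rfl fun j _ => by ring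
      _ < M * w i := mul_lt_mul_of_pos_left (h i) hM0
      _ = ‖z i‖ := hzi.symm
  have h2 : 0 < ‖z i‖ := hzi ▸ mul_pos hM0 (hw i)
  have h3 : ‖μ‖ < 1 := by nlinarith
  exact_mod_cast h3

theorem le_spectralRadius_of_eigenvector [DecidableEq ι] [Nonempty ι] {J : Matrix ι ι ℝ} {r : ℝ}
    {v : ι → ℝ} (hr : 0 ≤ r) (hv : ∀ i, 0 < v i) (h : J *ᵥ v = r • v) :
    ENNReal.ofReal r ≤ spectralRadius ℂ (J.map (fun r : ℝ => (r : ℂ))) := by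
  have hmem : (r : ℂ) ∈ spectrum ℂ (J.map (fun r : ℝ => (r : ℂ))) := by
    refine exists_eq_mulVec_of_mem_spectrum.2 ⟨fun i => (v i : ℂ), ?_, ?_⟩
    · obtain ⟨i⟩ := ‹Nonempty ι›
      exact Function.ne_iff.2 ⟨i, by simpa using (hv i).ne'⟩
    · ext i
      have := congrFun h i
      simp only [Matrix.mulVec, dotProduct, Pi.smul_apply, smul_eq_mul, Matrix.map_apply] at this ⊢
      exact_mod_cast this
  refine le_trans (le_of_eq ?_) (le_iSup₂ (f := fun k (_ : k ∈ spectrum ℂ _) => (‖k‖₊ : ENNReal))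
    (r : ℂ) hmem)
  rw [ENNReal.ofReal, ENNReal.coe_inj]
  ext
  simp [hr, abs_of_nonneg]

/-- Sequences dominated by a positive matrix with spectral radius below `1` decay at least as
fast as the powers of the spectral radius. -/
theorem exists_le_spectralRadius_pow [DecidableEq ι] [Nonempty ι] {J : Matrix ι ι ℝ}
    (hJ : ∀ i j, 0 < J i j)
    (hρ : spectralRadius ℂ (J.map (fun r : ℝ => (r : ℂ))) < 1) {t : ℕ → ι → ℝ}
    (ht : ∀ k, t (k + 1) ≤ J *ᵥ t k) :
    ∃ v : ι → ℝ, ∀ k,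
      t k ≤ (spectralRadius ℂ (J.map (fun r : ℝ => (r : ℂ)))).toReal ^ k • v := by
  obtain ⟨r, v, hr, hv, hJv⟩ := exists_pos_eigenvector hJ
  have hrρ : r ≤ (spectralRadius ℂ (J.map (fun r : ℝ => (r : ℂ)))).toReal :=
    (ENNReal.ofReal_le_iff_le_toReal hρ.ne_top).1 (le_spectralRadius_of_eigenvector hr.le hv hJv)
  -- As `v` is positive, some multiple dominates `t 0`; monotonicity of `J` propagates this with a
  -- factor `r` at each step.
  obtain ⟨C, hC0, hC⟩ : ∃ C : ℝ, 0 ≤ C ∧ t 0 ≤ C • v := by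
    obtain ⟨i, hi⟩ := Finite.exists_max fun i => |t 0 i| / v i
    exact ⟨_, div_nonneg (abs_nonneg _) (hv i).le,
      fun j => (le_abs_self _).trans ((div_le_iff₀ (hv j)).1 (hi j))⟩
  have hk : ∀ k, t k ≤ r ^ k • C • v := by
    intro k
    induction k with
    | zero => simpa using hC
    | succ k ih =>
      refine (ht k).trans ((mulVec_mono (fun i j => (hJ i j).le) ih).trans_eq ?_)
      rw [Matrix.mulVec_smul, Matrix.mulVec_smul, hJv, pow_succ, mul_smul, smul_comm C r v]
  refine ⟨C • v, fun k => (hk k).trans fun i => ?_⟩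
  simp only [Pi.smul_apply, smul_eq_mul]
  have := mul_nonneg hC0 (hv i).le
  gcongr

end Positive

/-! ### One step of the algorithm -/

section ErrorNorms

variable {n p : ℕ} {X P : BigMatrix n p} {N : Seminorm ℝ (StackedVec n p)} {σ : ℝ}

theorem PowLimit.toOp_sub_apply (h : PowLimit X P) (v : StackedVec n p) :
    toOp (X - P) (v - toOp P v) = toOp X v - toOp P v := by
  have h1 : toOp X (toOp P v) = toOp P v := by
    rw [← mul_apply_eq_comp, ← toOp_mul, h.mul_left]
  have h2 : toOp P (toOp P v) = toOp P v := by
    rw [← mul_apply_eq_comp, ← toOp_mul, h.mul_self]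
  rw [toOp_sub, sub_apply, map_sub, map_sub, h1, h2]
  abel

theorem PowLimit.toOp_toOp_apply (h : PowLimit X P) (v : StackedVec n p) :
    toOp P (toOp X v) = toOp P v := by
  rw [← mul_apply_eq_comp, ← toOp_mul, h.mul_right]

theorem PowLimit.toOp_sub_toOp (h : PowLimit X P) (v : StackedVec n p) :
    toOp (X - 1) (v - toOp P v) = toOp X v - v := by
  have h1 : toOp X (toOp P v) = toOp P v := by
    rw [← mul_apply_eq_comp, ← toOp_mul, h.mul_left]
  rw [toOp_sub, toOp_one, sub_apply, map_sub, h1,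
    one_apply_eq_self]
  abel

theorem IsContractionNorm.consensus_step_le (hN : IsContractionNorm X N σ) (h : PowLimit X P)
    {m : ℝ} (hm : 0 ≤ m) (le_m : ∀ v, N v ≤ m * ‖v‖) {η : ℝ} (hη : 0 ≤ η)
    (x y : StackedVec n p) :
    N (toOp X x - η • y - toOp P (toOp X x - η • y)) ≤
      σ * N (x - toOp P x) + m * (specNorm (1 - P) * (η * ‖y‖)) := by
  -- Since `P X = P` and `X - P` kills the range of `P`, the consensus error evolves under `X - P`
  -- alone, driven by `(1 - P) (η y)`.
  have e : toOp X x - η • y - toOp P (toOp X x - η • y) =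
      toOp (X - P) (x - toOp P x) - toOp (1 - P) (η • y) := by
    rw [h.toOp_sub_apply, map_sub, h.toOp_toOp_apply, toOp_sub 1 P, toOp_one,
      sub_apply, one_apply_eq_self]
    abel
  rw [e]
  refine (map_sub_le_add N _ _).trans (add_le_add ?_ ?_)
  · simpa only [h.infPow_eq] using hN.bound (x - toOp P x)
  · refine (le_m _).trans (mul_le_mul_of_nonneg_left ((norm_toOp_le _ _).trans_eq ?_) hm)
    rw [norm_smul, Real.norm_of_nonneg hη]

theorem IsContractionNorm.tracking_step_le (hN : IsContractionNorm X N σ) (h : PowLimit X P)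
    {l : ℝ} (le_l : ∀ v, N v ≤ l * ‖v‖) (y d : StackedVec n p) :
    N (toOp X (y + d) - toOp P (toOp X (y + d))) ≤ σ * N (y - toOp P y) + σ * (l * ‖d‖) := by
  have e : toOp X (y + d) - toOp P (toOp X (y + d)) =
      toOp (X - P) (y - toOp P y) + toOp (X - P) d := by
    rw [h.toOp_toOp_apply, h.toOp_sub_apply, toOp_sub, sub_apply, map_add,
      map_add]
    abel
  have hb : ∀ v, N (toOp (X - P) v) ≤ σ * N v := by simpa only [h.infPow_eq] using hN.bound
  rw [e]
  refine (map_add_le_add N _ _).trans (add_le_add (hb _) ((hb _).trans ?_))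
  exact mul_le_mul_of_nonneg_left (le_l d) hN.sigma_pos.le

end ErrorNorms

/-! ### Gradient tracking and the three rows of the error recursion. -/

section Algorithm

variable {n p : ℕ} {f : Fin n → Vec p → ℝ} {α β : ℝ} {z : Vec p}

/-- The stacked vector of the local gradients. -/
noncomputable def stackedGradient (f : Fin n → Vec p → ℝ) (v : Fin n → Vec p) : StackedVec n p :=
  stack fun i => ∇ (f i) (v i)

theorem IsAdmissible.norm_stackedGradient_sub_le (hf : IsAdmissible f α β)
    (v w : Fin n → Vec p) :
    ‖stackedGradient f v - stackedGradient f w‖ ≤ β * ‖stack v - stack w‖ :=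
  norm_stack_le (v := fun i => ∇ (f i) (v i) - ∇ (f i) (w i)) (w := fun i => v i - w i)
    hf.beta_pos.le fun i => hf.lipschitz i (v i) (w i)

theorem toOp_leftLimit_stack (π : Fin n → ℝ) (v : Fin n → Vec p) :
    toOp (kronI p (Matrix.of fun _ j => π j)) (stack v) = stack fun _ => ∑ j, π j • v j := by
  rw [toOp_kronI_stack]
  rfl

theorem toOp_rightLimit_stack (π : Fin n → ℝ) (v : Fin n → Vec p) :
    toOp (kronI p (Matrix.of fun i _ => π i)) (stack v) = stack fun i => π i • ∑ j, v j := by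
  rw [toOp_kronI_stack]
  simp only [Matrix.of_apply, Finset.smul_sum]

variable {A B : Matrix (Fin n) (Fin n) ℝ} {η : ℝ} {x₀ : Fin n → Vec p}

theorem xIter_succ (k : ℕ) : xIter A B f η x₀ (k + 1) =
    toOp (kronI p A) (xIter A B f η x₀ k) - η • yIter A B f η x₀ k := by
  rw [xIter, xIter, yIter, toOp_kronI_stack, ← stack_smul, ← stack_sub]
  rfl

theorem yIter_succ (k : ℕ) : yIter A B f η x₀ (k + 1) =
    toOp (kronI p B) (yIter A B f η x₀ k + (stackedGradient f (iter A B f η x₀ (k + 1)).1 -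
      stackedGradient f (iter A B f η x₀ k).1)) := by
  rw [yIter, yIter, stackedGradient, stackedGradient, ← stack_sub, ← stack_add, toOp_kronI_stack]
  simp only [← add_sub_assoc]
  rfl

/-- The tracking invariant: `Q` absorbs the weights, so the gradient increments telescope, and the
initialisation `y_i(0) = ∇ f_i (x_i(0))` starts the sum correctly. -/
theorem toOp_yIter {Q : BigMatrix n p} (hQ : PowLimit (kronI p B) Q) (k : ℕ) :
    toOp Q (yIter A B f η x₀ k) = toOp Q (stackedGradient f (iter A B f η x₀ k).1) := by
  induction k with
  | zero => rfl
  | succ k ih =>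
    rw [yIter_succ, hQ.toOp_toOp_apply, map_add, map_sub, ih]
    abel

/-- Split off `Q y`. By tracking it is `Q` applied to the stacked gradient, and `Q` annihilates the
stacked gradient at the optimum because the local gradients sum to zero there; the Lipschitz bound
does the rest. -/
theorem IsAdmissible.norm_yIter_le (hf : IsAdmissible f α β) (hn : 0 < n) (hz : IsOptimal f z)
    {πc : Fin n → ℝ} (hQ : PowLimit (kronI p B) (kronI p (Matrix.of fun i _ => πc i)))
    (P : BigMatrix n p) {NA NB : Seminorm ℝ (StackedVec n p)} {g h l m : ℝ}
    (hc : IsEquivConsts NA NB g h l m) (k : ℕ) :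
    ‖yIter A B f η x₀ k‖ ≤
      h * NB (yIter A B f η x₀ k -
        toOp (kronI p (Matrix.of fun i _ => πc i)) (yIter A B f η x₀ k)) +
      specNorm (kronI p (Matrix.of fun i _ => πc i)) *
        (β * (g * NA (xIter A B f η x₀ k - toOp P (xIter A B f η x₀ k)) +
          ‖toOp P (xIter A B f η x₀ k) - stack fun _ => z‖)) := by
  set Q := kronI p (Matrix.of fun i _ => πc i) with hQdef
  set x := xIter A B f η x₀ k with hx
  set y := yIter A B f η x₀ k with hy
  have hzero : toOp Q (stackedGradient f fun _ => z) = 0 := by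
    rw [stackedGradient, hQdef, toOp_rightLimit_stack, hf.sum_gradient_eq_zero hn hz]
    simp only [smul_zero]
    rfl
  have h1 : toOp Q y = toOp Q (stackedGradient f (iter A B f η x₀ k).1 -
      stackedGradient f fun _ => z) := by
    rw [map_sub, hzero, sub_zero, hy, toOp_yIter hQ]
  have h2 : ‖toOp Q y‖ ≤ specNorm Q * (β * (g * NA (x - toOp P x) +
      ‖toOp P x - stack fun _ => z‖)) := by
    rw [h1]
    refine (norm_toOp_le _ _).trans (mul_le_mul_of_nonneg_left ?_ (specNorm_nonneg _))
    refine (hf.norm_stackedGradient_sub_le _ _).trans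
      (mul_le_mul_of_nonneg_left ?_ hf.beta_pos.le)
    calc ‖x - stack fun _ => z‖ = ‖(x - toOp P x) + (toOp P x - stack fun _ => z)‖ := by
          rw [sub_add_sub_cancel]
      _ ≤ _ := (norm_add_le _ _).trans (add_le_add_left (hc.le_g _) _)
  calc ‖y‖ = ‖(y - toOp Q y) + toOp Q y‖ := by rw [sub_add_cancel]
    _ ≤ _ := (norm_add_le _ _).trans (add_le_add (hc.le_h _) h2)

theorem IsAdmissible.optimality_step_le (hf : IsAdmissible f α β) (hn : 0 < n)
    (hz : IsOptimal f z) {πr πc : Fin n → ℝ} (hr : 0 ≤ πr ⬝ᵥ πc) (hη : 0 ≤ η)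
    (hP : PowLimit (kronI p A) (kronI p (Matrix.of fun _ j => πr j)))
    (hQ : PowLimit (kronI p B) (kronI p (Matrix.of fun i _ => πc i))) (k : ℕ) :
    ‖toOp (kronI p (Matrix.of fun _ j => πr j)) (xIter A B f η x₀ (k + 1)) - stack fun _ => z‖ ≤
      max |1 - α * n * η * (πr ⬝ᵥ πc)| |1 - β * n * η * (πr ⬝ᵥ πc)| *
        ‖toOp (kronI p (Matrix.of fun _ j => πr j)) (xIter A B f η x₀ k) - stack fun _ => z‖ +
      η * (πr ⬝ᵥ πc) * β * n * ‖xIter A B f η x₀ k -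
        toOp (kronI p (Matrix.of fun _ j => πr j)) (xIter A B f η x₀ k)‖ +
      η * (specNorm (kronI p (Matrix.of fun _ j => πr j)) * ‖yIter A B f η x₀ k -
        toOp (kronI p (Matrix.of fun i _ => πc i)) (yIter A B f η x₀ k)‖) := by
  set P := kronI p (Matrix.of fun _ j => πr j) with hPdef
  set Q := kronI p (Matrix.of fun i _ => πc i) with hQdef
  set v := (iter A B f η x₀ k).1 with hv
  set x := xIter A B f η x₀ k with hx
  have hxv : x = stack v := rfl
  set y := yIter A B f η x₀ k with hy
  set c := πr ⬝ᵥ πc with hcdef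
  set u := ∑ j, πr j • v j with hu
  set S := ∑ i, ∇ (f i) (v i) with hS
  set S' := ∑ i, ∇ (f i) u with hS'
  have hPx : toOp P x = stack fun _ => u := by rw [hxv, hPdef, toOp_leftLimit_stack]
  have hPQ : toOp P (toOp Q y) = stack fun _ => c • S := by
    rw [hy, toOp_yIter hQ, stackedGradient, hQdef, toOp_rightLimit_stack, hPdef,
      toOp_leftLimit_stack]
    simp only [smul_smul, ← Finset.sum_smul]
    rfl
  -- The weighted mean `u` makes an exact gradient step of size `η * c`. The corrections are `S' -
  -- S`, from evaluating gradients at the `x_i` instead of `u`, and the part of `y` outside the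
  -- range of `Q`.
  have e : toOp P (xIter A B f η x₀ (k + 1)) - stack (fun _ => z) =
      (stack fun _ => u - z - (η * c) • S' + (η * c) • (S' - S)) -
        η • toOp P (y - toOp Q y) := by
    have e1 : (stack fun _ : Fin n => u - z - (η * c) • S' + (η * c) • (S' - S)) =
        stack (fun _ => u) - stack (fun _ => z) - η • stack (fun _ : Fin n => c • S) := by
      rw [← stack_smul, ← stack_sub, ← stack_sub]
      congr 1
      ext1 i
      module
    rw [e1, xIter_succ, map_sub, map_smul, hP.toOp_toOp_apply, ← hx, ← hy, map_sub, hPx, hPQ,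
      smul_sub]
    abel
  have h1 := hf.norm_average_step_le hn hz (η * c) u
  have h2 : ‖S' - S‖ ≤ β * (√n * ‖x - toOp P x‖) := by
    rw [hS, hS', ← Finset.sum_sub_distrib]
    calc ‖∑ i, (∇ (f i) u - ∇ (f i) (v i))‖ ≤ ∑ i, β * ‖v i - u‖ := by
          refine (norm_sum_le _ _).trans (Finset.sum_le_sum fun i _ => ?_)
          rw [norm_sub_rev (v i)]
          exact hf.lipschitz i _ _
      _ ≤ _ := by
          rw [← Finset.mul_sum, hPx, hxv, ← stack_sub]
          exact mul_le_mul_of_nonneg_left (sum_norm_le_norm_stack _) hf.beta_pos.le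
  have hηc : 0 ≤ η * c := mul_nonneg hη hr
  -- The factor `n` in the `(2, 1)` entry of `J` has two halves: Cauchy–Schwarz over the agents, and
  -- the norm of a vector of `n` equal blocks.
  have hsq : √(n : ℝ) * √n = n := Real.mul_self_sqrt (by positivity)
  have h3 : ‖u - z - (η * c) • S' + (η * c) • (S' - S)‖ ≤
      max |1 - α * (n * (η * c))| |1 - β * (n * (η * c))| * ‖u - z‖ +
        (η * c) * (β * (√n * ‖x - toOp P x‖)) := by
    refine (norm_add_le _ _).trans (add_le_add h1 ?_)
    rw [norm_smul, Real.norm_of_nonneg hηc]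
    exact mul_le_mul_of_nonneg_left h2 hηc
  rw [e]
  refine (norm_sub_le _ _).trans (add_le_add ?_ ?_)
  · rw [norm_stack_const, hPx, ← stack_sub, norm_stack_const, ← hPx]
    refine (mul_le_mul_of_nonneg_left h3 (Real.sqrt_nonneg _)).trans_eq ?_
    have e2 : ∀ a : ℝ, a * (n * (η * c)) = a * n * η * c := fun a => by ring
    rw [e2, e2]
    linear_combination (η * c * β * ‖x - toOp P x‖) * hsq
  · rw [norm_smul, Real.norm_of_nonneg hη]
    exact mul_le_mul_of_nonneg_left (norm_toOp_le _ _) hη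

theorem IsAdmissible.norm_stackedGradient_step_le (hf : IsAdmissible f α β) (hη : 0 ≤ η)
    {P : BigMatrix n p} (hP : PowLimit (kronI p A) P) {NA NB : Seminorm ℝ (StackedVec n p)}
    {g h l m : ℝ} (hc : IsEquivConsts NA NB g h l m) (k : ℕ) :
    ‖stackedGradient f (iter A B f η x₀ (k + 1)).1 - stackedGradient f (iter A B f η x₀ k).1‖ ≤
      β * (specNorm (kronI p A - 1) *
        (g * NA (xIter A B f η x₀ k - toOp P (xIter A B f η x₀ k))) +
        η * ‖yIter A B f η x₀ k‖) := by
  refine (hf.norm_stackedGradient_sub_le _ _).trans (mul_le_mul_of_nonneg_left ?_ hf.beta_pos.le)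
  have e : stack (iter A B f η x₀ (k + 1)).1 - stack (iter A B f η x₀ k).1 =
      toOp (kronI p A - 1) (xIter A B f η x₀ k - toOp P (xIter A B f η x₀ k)) -
        η • yIter A B f η x₀ k := by
    rw [hP.toOp_sub_toOp]
    change xIter A B f η x₀ (k + 1) - xIter A B f η x₀ k = _
    rw [xIter_succ]
    abel
  rw [e]
  refine (norm_sub_le _ _).trans (add_le_add ((norm_toOp_le _ _).trans ?_) ?_)
  · exact mul_le_mul_of_nonneg_left (hc.le_g _) (specNorm_nonneg _)
  · rw [norm_smul, Real.norm_of_nonneg hη]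

/-- The entrywise linear inequality between consecutive error vectors. -/
theorem IsAdmissible.errorVec_succ_le (hf : IsAdmissible f α β) (hn : 0 < n)
    (hz : IsOptimal f z) {πr πc : Fin n → ℝ} (hr : 0 ≤ πr ⬝ᵥ πc) (hη : 0 ≤ η)
    {P Q : BigMatrix n p} (hPdef : P = kronI p (Matrix.of fun _ j => πr j))
    (hQdef : Q = kronI p (Matrix.of fun i _ => πc i))
    (hP : PowLimit (kronI p A) P) (hQ : PowLimit (kronI p B) Q)
    {NA NB : Seminorm ℝ (StackedVec n p)} {σA σB g h l m : ℝ}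
    (hNA : IsContractionNorm (kronI p A) NA σA) (hNB : IsContractionNorm (kronI p B) NB σB)
    (hc : IsEquivConsts NA NB g h l m) (k : ℕ) :
    errorVec P Q NA NB z (xIter A B f η x₀ (k + 1)) (yIter A B f η x₀ (k + 1)) ≤
      errorMatrix σA σB (max |1 - α * n * η * (πr ⬝ᵥ πc)| |1 - β * n * η * (πr ⬝ᵥ πc)|) η
        (m * g * β * specNorm (1 - P) * specNorm Q) (m * β * specNorm (1 - P) * specNorm Q)
        (m * h * specNorm (1 - P)) (n * β * g * (πr ⬝ᵥ πc)) (h * specNorm P)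
        (g * σB * l * β * specNorm (kronI p A - 1)) (g * σB * l * β ^ 2 * specNorm Q)
        (σB * l * β ^ 2 * specNorm Q) (h * σB * l * β) *ᵥ
      errorVec P Q NA NB z (xIter A B f η x₀ k) (yIter A B f η x₀ k) := by
  have hy := hf.norm_yIter_le (A := A) (η := η) (x₀ := x₀) hn hz (hQdef ▸ hQ) P hc k
  have hgr := hf.norm_stackedGradient_step_le (B := B) (x₀ := x₀) hη hP hc k
  have h1 := hNA.consensus_step_le hP hc.m_pos.le hc.le_m hη (xIter A B f η x₀ k)
    (yIter A B f η x₀ k)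
  have h2 := hf.optimality_step_le (x₀ := x₀) hn hz hr hη (hPdef ▸ hP) (hQdef ▸ hQ) k
  have h3 := hNB.tracking_step_le hQ hc.le_l (yIter A B f η x₀ k)
    (stackedGradient f (iter A B f η x₀ (k + 1)).1 - stackedGradient f (iter A B f η x₀ k).1)
  generalize πr ⬝ᵥ πc = c at hr h2 ⊢
  rw [← xIter_succ] at h1
  rw [← yIter_succ] at h3
  rw [← hPdef, ← hQdef] at h2
  rw [← hQdef] at hy
  have hgA := hc.le_g (xIter A B f η x₀ k - toOp P (xIter A B f η x₀ k))
  have hhB := hc.le_h (yIter A B f η x₀ k - toOp Q (yIter A B f η x₀ k))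
  set t₁ := NA (xIter A B f η x₀ k - toOp P (xIter A B f η x₀ k)) with ht₁
  set t₂ := ‖toOp P (xIter A B f η x₀ k) - stack fun _ => z‖ with ht₂
  set t₃ := NB (yIter A B f η x₀ k - toOp Q (yIter A B f η x₀ k)) with ht₃
  have hβ := hf.beta_pos
  have hσ := hNB.sigma_pos
  have hl := hc.l_pos
  have hm := hc.m_pos
  have s1 := specNorm_nonneg (1 - P)
  have s2 := specNorm_nonneg P
  have key : errorVec P Q NA NB z (xIter A B f η x₀ k) (yIter A B f η x₀ k) = ![t₁, t₂, t₃] := rfl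
  rw [key]
  intro i
  fin_cases i
  · change NA _ ≤ _
    simp only [errorMatrix, Matrix.mulVec, dotProduct, Fin.sum_univ_three]
    refine h1.trans ?_
    -- Inserting the bound on `‖y‖` produces the first row; the third row uses it through the
    -- gradient increment.
    calc _ ≤ σA * t₁ + m * (specNorm (1 - P) * (η * (h * t₃ +
          specNorm Q * (β * (g * t₁ + t₂))))) := by gcongr
      _ = _ := by
          simp
          ring
  · change ‖_‖ ≤ _
    simp only [errorMatrix, Matrix.mulVec, dotProduct, Fin.sum_univ_three]
    refine h2.trans ?_
    calc _ ≤ max |1 - α * n * η * c| |1 - β * n * η * c| * t₂ +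
          η * c * β * n * (g * t₁) + η * (specNorm P * (h * t₃)) := by gcongr
      _ = _ := by
          simp
          ring
  · change NB _ ≤ _
    simp only [errorMatrix, Matrix.mulVec, dotProduct, Fin.sum_univ_three]
    refine h3.trans ?_
    calc _ ≤ σB * t₃ + σB * (l * (β * (specNorm (kronI p A - 1) * (g * t₁) +
          η * (h * t₃ + specNorm Q * (β * (g * t₁ + t₂)))))) := by
          gcongr
          refine hgr.trans ?_
          gcongr
      _ = _ := by
          simp
          ring

end Algorithm

/-! ### Positivity of the constants -/

section Positivity

variable {n p : ℕ} {G : Digraph (Fin n)} {A : Matrix (Fin n) (Fin n) ℝ}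

theorem kronI_ne_zero {M : Matrix (Fin n) (Fin n) ℝ} {i j : Fin n} (hp : 0 < p)
    (h : M i j ≠ 0) : kronI p M ≠ 0 := fun h0 => h <| by
  rw [← kronI_apply_same M i j (⟨0, hp⟩ : Fin p), h0, Matrix.zero_apply]

theorem kronI_ne_one {M : Matrix (Fin n) (Fin n) ℝ} {i j : Fin n} (hp : 0 < p) (hij : i ≠ j)
    (h : M i j ≠ 0) : kronI p M ≠ 1 := fun h1 => h <| by
  rw [← kronI_apply_same M i j (⟨0, hp⟩ : Fin p), h1, Matrix.one_apply_ne]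
  simpa using hij

theorem PowLimit.ne_one {X P : BigMatrix n p} (h : PowLimit X P) (hP : P ≠ 1) : X ≠ 1 := by
  rintro rfl
  refine hP (tendsto_nhds_unique h ?_)
  simp only [one_pow]
  exact tendsto_const_nhds

theorem IsRowWeights.kronI_eq_one (hA : IsRowWeights G A) (hn : 0 < n) (h : ¬(2 ≤ n ∧ 1 ≤ p)) :
    kronI p A = 1 := by
  rcases Nat.eq_zero_or_pos p with rfl | hp
  · exact Subsingleton.elim _ _
  · obtain rfl : n = 1 := by lia
    have : A = 1 := by
      ext i j
      have := hA.row_sum 0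
      fin_cases i
      fin_cases j
      simpa using this
    rw [this, kronI, Matrix.one_kronecker_one]

/-- The hypotheses are the three rows of `J ε < ε` solved for `η` or for `ε₂`; in the middle row the
factor `η` cancels, leaving a condition on `ε₂` alone. -/
theorem errorMatrix_mulVec_lt {σA σB lam η a₁ a₂ a₃ a₄ a₅ a₆ a₇ a₈ a₉ c ε₁ ε₂ ε₃ : ℝ}
    (hη : 0 < η) (hc : 0 < c)
    (h1 : 0 < a₁ * ε₁ + a₂ * ε₂ + a₃ * ε₃) (h3 : 0 < a₇ * ε₁ + a₈ * ε₂ + a₉ * ε₃)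
    (hlam : lam = 1 - c * η) (h2 : (a₄ * ε₁ + a₅ * ε₃) / c < ε₂)
    (hη1 : η < ε₁ * (1 - σA) / (a₁ * ε₁ + a₂ * ε₂ + a₃ * ε₃))
    (hη3 : η < ((1 - σB) * ε₃ - ε₁ * a₆) / (a₇ * ε₁ + a₈ * ε₂ + a₉ * ε₃)) (i : Fin 3) :
    (errorMatrix σA σB lam η a₁ a₂ a₃ a₄ a₅ a₆ a₇ a₈ a₉ *ᵥ ![ε₁, ε₂, ε₃]) i <
      ![ε₁, ε₂, ε₃] i := by
  rw [lt_div_iff₀ h1] at hη1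
  rw [lt_div_iff₀ h3] at hη3
  rw [div_lt_iff₀ hc] at h2
  have h2' := mul_lt_mul_of_pos_left h2 hη
  fin_cases i <;> simp [errorMatrix, Matrix.mulVec, dotProduct, Fin.sum_univ_three]
  · linarith
  · rw [hlam]; linarith
  · linarith

theorem norm_sub_stack_le_errorVec {P Q : BigMatrix n p} {NA NB : Seminorm ℝ (StackedVec n p)}
    {g h l m : ℝ} (hc : IsEquivConsts NA NB g h l m) (z : Vec p) (x y : StackedVec n p) :
    ‖x - stack fun _ => z‖ ≤
      g * errorVec P Q NA NB z x y 0 + errorVec P Q NA NB z x y 1 := by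
  calc ‖x - stack fun _ => z‖ = ‖(x - toOp P x) + (toOp P x - stack fun _ => z)‖ := by
        rw [sub_add_sub_cancel]
    _ ≤ _ := (norm_add_le _ _).trans (add_le_add_left (hc.le_g _) _)

end Positivity

end DirOpt

/-! ### Assembly of the existence statements, the recursion and the convergence rate. -/

theorem theorem1 {n p : ℕ} (hn : 0 < n) (G : Digraph (Fin n)) (hG : StronglyConnected G)
    (A B : Matrix (Fin n) (Fin n) ℝ) (hA : IsRowWeights G A) (hB : IsColWeights G B)
    (f : Fin n → Vec p → ℝ) (α β : ℝ) (hf : IsAdmissible f α β) :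
    -- The objects that occur in the result exist.
    (∃! πr, IsLeftEigvec A πr) ∧ (∃! πc, IsRightEigvec B πc) ∧ (∃! z, IsOptimal f z) ∧
    Tendsto (fun k : ℕ => kronI p A ^ k) atTop (𝓝 (infPow (kronI p A))) ∧
    Tendsto (fun k : ℕ => kronI p B ^ k) atTop (𝓝 (infPow (kronI p B))) ∧
    (∃ (NA NB : Seminorm ℝ (StackedVec n p)) (σA σB g h l m : ℝ),
      IsContractionNorm (kronI p A) NA σA ∧ IsContractionNorm (kronI p B) NB σB ∧
      IsEquivConsts NA NB g h l m) ∧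
    -- The result holds for every choice of them.
    ∀ (πr πc : Fin n → ℝ) (xs : Vec p) (Ainf Binf : BigMatrix n p)
      (NA NB : Seminorm ℝ (StackedVec n p)) (σA σB g h l m : ℝ)
      (a₁ a₂ a₃ a₄ a₅ a₆ a₇ a₈ a₉ : ℝ) (lam : ℝ → ℝ) (J : ℝ → Matrix (Fin 3) (Fin 3) ℝ),
      IsLeftEigvec A πr → IsRightEigvec B πc → IsOptimal f xs →
      Ainf = infPow (kronI p A) → Binf = infPow (kronI p B) →
      IsContractionNorm (kronI p A) NA σA → IsContractionNorm (kronI p B) NB σB →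
      IsEquivConsts NA NB g h l m →
      a₁ = m * g * β * specNorm (1 - Ainf) * specNorm Binf →
      a₂ = m * β * specNorm (1 - Ainf) * specNorm Binf →
      a₃ = m * h * specNorm (1 - Ainf) →
      a₄ = n * β * g * (πr ⬝ᵥ πc) →
      a₅ = h * specNorm Ainf →
      a₆ = g * σB * l * β * specNorm (kronI p A - 1) →
      a₇ = g * σB * l * β ^ 2 * specNorm Binf →
      a₈ = σB * l * β ^ 2 * specNorm Binf →
      a₉ = h * σB * l * β →
      (∀ η, lam η = max |1 - α * n * η * (πr ⬝ᵥ πc)| |1 - β * n * η * (πr ⬝ᵥ πc)|) →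
      (∀ η, J η = errorMatrix σA σB (lam η) η a₁ a₂ a₃ a₄ a₅ a₆ a₇ a₈ a₉) →
      -- The constants are positive (outside the degenerate cases) and `J(η)` is nonnegative.
      (2 ≤ n → 1 ≤ p → 0 < a₁ ∧ 0 < a₂ ∧ 0 < a₃ ∧ 0 < a₄ ∧ 0 < a₅ ∧ 0 < a₆ ∧ 0 < a₇ ∧
        0 < a₈ ∧ 0 < a₉) ∧
      (∀ η, 0 < η → ∀ i j, 0 ≤ J η i j) ∧
      -- The entrywise linear inequality.
      (∀ η, 0 < η → η < 2 / (n * β * (πr ⬝ᵥ πc)) → ∀ (x₀ : Fin n → Vec p) (k : ℕ),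
        errorVec Ainf Binf NA NB xs (xIter A B f η x₀ (k + 1)) (yIter A B f η x₀ (k + 1)) ≤
          J η *ᵥ errorVec Ainf Binf NA NB xs (xIter A B f η x₀ k) (yIter A B f η x₀ k)) ∧
      -- Geometric convergence for small step-sizes.
      (∀ ε₁ ε₂ ε₃ η : ℝ, 0 < ε₁ → 0 < ε₂ → 0 < ε₃ →
        ε₁ < (1 - σB) * ε₃ / a₆ →
        (a₄ * ε₁ + a₅ * ε₃) / (α * n * (πr ⬝ᵥ πc)) < ε₂ →
        0 < η →
        η < min (ε₁ * (1 - σA) / (a₁ * ε₁ + a₂ * ε₂ + a₃ * ε₃))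
              (min (((1 - σB) * ε₃ - ε₁ * a₆) / (a₇ * ε₁ + a₈ * ε₂ + a₉ * ε₃))
                (1 / (n * β * (πr ⬝ᵥ πc)))) →
        specRadius (J η) < 1 ∧
        ∀ x₀ : Fin n → Vec p,
          Tendsto (fun k => ‖xIter A B f η x₀ k - stack (fun _ => xs)‖) atTop (𝓝 0) ∧
          (fun k => ‖xIter A B f η x₀ k - stack (fun _ => xs)‖) =O[atTop]
            fun k => (specRadius (J η)).toReal ^ k) := by
  obtain ⟨πr₀, hπr₀, hπr_unique⟩ := hA.existsUnique_leftEigvec hG hn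
  obtain ⟨πc₀, hπc₀, hπc_unique⟩ := hB.transpose.existsUnique_leftEigvec hG.reversed hn
  have hPA : PowLimit (kronI p A) (kronI p (Matrix.of fun _ j => πr₀ j)) :=
    powLimit_kronI (hA.tendsto_pow hG hn hπr₀)
  have hPB : PowLimit (kronI p B) (kronI p (Matrix.of fun i _ => πc₀ i)) :=
    powLimit_kronI (hB.tendsto_pow hG hn (isRightEigvec_iff.2 hπc₀))
  refine ⟨⟨πr₀, hπr₀, hπr_unique⟩, ⟨πc₀, isRightEigvec_iff.2 hπc₀,
    fun π hπ => hπc_unique π (isRightEigvec_iff.1 hπ)⟩, hf.existsUnique_isOptimal hn,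
    hPA.infPow_eq.symm ▸ hPA, hPB.infPow_eq.symm ▸ hPB, ?_, ?_⟩
  · obtain ⟨NA, σA, CA, hNA, hCA, hA1, hA2⟩ := hPA.exists_contractionNorm
    obtain ⟨NB, σB, CB, hNB, hCB, hB1, hB2⟩ := hPB.exists_contractionNorm
    exact ⟨NA, NB, σA, σB, 1, 1, CB, CA, hNA, hNB, one_pos, one_pos, hCB, hCA,
      fun v => (hA1 v).trans_eq (one_mul _).symm, fun v => (hB1 v).trans_eq (one_mul _).symm,
      hB2, hA2⟩
  intro πr πc xs Ainf Binf NA NB σA σB g h l m a₁ a₂ a₃ a₄ a₅ a₆ a₇ a₈ a₉ lam J hπr hπc hxs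
    hAinf hBinf hNA hNB hc ha₁ ha₂ ha₃ ha₄ ha₅ ha₆ ha₇ ha₈ ha₉ hlam hJ
  obtain rfl := hπr_unique πr hπr
  obtain rfl := hπc_unique πc (isRightEigvec_iff.1 hπc)
  rw [hPA.infPow_eq] at hAinf
  rw [hPB.infPow_eq] at hBinf
  rw [← hAinf] at hPA
  rw [← hBinf] at hPB
  have hr := hA.leftEigvec_pos hG hn hπr
  have hcp := hB.transpose.leftEigvec_pos hG.reversed hn hπc₀
  have hnp : (0 : ℝ) < n := by positivity
  have hrc : 0 < πr ⬝ᵥ πc :=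
    Finset.sum_pos (fun i _ => mul_pos (hr i) (hcp i)) ⟨⟨0, hn⟩, Finset.mem_univ _⟩
  have hα := hf.alpha_pos
  have hβ := hf.beta_pos
  have hσA := hNA.sigma_pos
  have hσB := hNB.sigma_pos
  have hg := hc.g_pos
  have hh := hc.h_pos
  have hl := hc.l_pos
  have hm := hc.m_pos
  have hpos : 2 ≤ n → 1 ≤ p → 0 < a₁ ∧ 0 < a₂ ∧ 0 < a₃ ∧ 0 < a₄ ∧ 0 < a₅ ∧ 0 < a₆ ∧ 0 < a₇ ∧
      0 < a₈ ∧ 0 < a₉ := by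
    intro hn2 hp
    have hne : (⟨0, hn⟩ : Fin n) ≠ ⟨1, hn2⟩ := by simp
    -- `A_∞` has a nonzero off-diagonal entry, namely a coordinate of the positive vector `π_r`.
    have hA1 : Ainf ≠ 1 := hAinf ▸ kronI_ne_one hp hne (hr ⟨1, hn2⟩).ne'
    have s1 : 0 < specNorm (1 - Ainf) := specNorm_pos (sub_ne_zero.2 hA1.symm)
    have s2 : 0 < specNorm Ainf :=
      specNorm_pos (hAinf ▸ kronI_ne_zero (i := ⟨0, hn⟩) hp (hr ⟨1, hn2⟩).ne')
    have s3 : 0 < specNorm Binf :=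
      specNorm_pos (hBinf ▸ kronI_ne_zero (j := ⟨0, hn⟩) hp (hcp ⟨1, hn2⟩).ne')
    have s4 : 0 < specNorm (kronI p A - 1) := specNorm_pos (sub_ne_zero.2 (hPA.ne_one hA1))
    rw [ha₁, ha₂, ha₃, ha₄, ha₅, ha₆, ha₇, ha₈, ha₉]
    clear hlam hJ
    generalize specNorm (1 - Ainf) = c₁ at s1 ⊢
    generalize specNorm Ainf = c₂ at s2 ⊢
    generalize specNorm Binf = c₃ at s3 ⊢
    generalize specNorm (kronI p A - 1) = c₄ at s4 ⊢
    generalize πr ⬝ᵥ πc = c₅ at hrc ⊢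
    refine ⟨?_, ?_, ?_, ?_, ?_, ?_, ?_, ?_, ?_⟩ <;> positivity
  have hstep : ∀ η, 0 < η → ∀ (x₀ : Fin n → Vec p) (k : ℕ),
      errorVec Ainf Binf NA NB xs (xIter A B f η x₀ (k + 1)) (yIter A B f η x₀ (k + 1)) ≤
        J η *ᵥ errorVec Ainf Binf NA NB xs (xIter A B f η x₀ k) (yIter A B f η x₀ k) := by
    intro η hη x₀ k
    rw [hJ, hlam, ha₁, ha₂, ha₃, ha₄, ha₅, ha₆, ha₇, ha₈, ha₉]
    exact hf.errorVec_succ_le hn hxs hrc.le hη.le hAinf hBinf hPA hPB hNA hNB hc k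
  refine ⟨hpos, ?_, fun η hη _ => hstep η hη, ?_⟩
  · intro η hη i j
    have s1 := specNorm_nonneg (1 - Ainf)
    have s2 := specNorm_nonneg Ainf
    have s3 := specNorm_nonneg Binf
    have s4 := specNorm_nonneg (kronI p A - 1)
    have hlam0 : 0 ≤ lam η := hlam η ▸ le_max_of_le_left (abs_nonneg _)
    rw [hJ, ha₁, ha₂, ha₃, ha₄, ha₅, ha₆, ha₇, ha₈, ha₉]
    generalize lam η = c₀ at hlam0 ⊢
    generalize specNorm (1 - Ainf) = c₁ at s1 ⊢
    generalize specNorm Ainf = c₂ at s2 ⊢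
    generalize specNorm Binf = c₃ at s3 ⊢
    generalize specNorm (kronI p A - 1) = c₄ at s4 ⊢
    generalize πr ⬝ᵥ πc = c₅ at hrc ⊢
    fin_cases i <;> fin_cases j <;> simp [errorMatrix] <;> positivity
  · intro ε₁ ε₂ ε₃ η hε₁ hε₂ hε₃ hε₁₃ hε₂' hη hηlt
    -- In the degenerate cases `A ⊗ I_p` is the identity, so `a₆ = 0`; as division by zero yields
    -- `0`, the condition on `ε₁` would read `ε₁ < 0`.
    have hnp2 : 2 ≤ n ∧ 1 ≤ p := by
      by_contra hcon
      rw [ha₆, hA.kronI_eq_one hn hcon, sub_self, specNorm, toOp_zero, norm_zero, mul_zero,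
        div_zero] at hε₁₃
      exact hε₁₃.not_gt hε₁
    obtain ⟨p1, p2, p3, p4, p5, p6, p7, p8, p9⟩ := hpos hnp2.1 hnp2.2
    obtain ⟨hη1, hη2⟩ := lt_min_iff.1 hηlt
    obtain ⟨hη3, hη4⟩ := lt_min_iff.1 hη2
    -- For `η < 1 / (n β π_r·π_c)` both moduli open without a sign change, and `α ≤ β` selects the
    -- first.
    have hlam1 : lam η = 1 - α * n * (πr ⬝ᵥ πc) * η := by
      rw [lt_div_iff₀ (by positivity)] at hη4
      have hle : α * n * η * (πr ⬝ᵥ πc) ≤ β * n * η * (πr ⬝ᵥ πc) := by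
        have := hf.alpha_le_beta hn hnp2.2
        gcongr
      rw [hlam, abs_of_nonneg (by linarith), abs_of_nonneg (by linarith),
        max_eq_left (by linarith)]
      ring
    -- Strict positivity of the middle entry makes all of `J η` positive, as the Perron argument
    -- requires.
    have hlam2 : 0 < lam η := by
      rw [lt_div_iff₀ (by positivity)] at hη4
      have : α * n * (πr ⬝ᵥ πc) * η ≤ β * n * (πr ⬝ᵥ πc) * η := by
        have := hf.alpha_le_beta hn hnp2.2
        gcongr
      linarith
    have hJpos : ∀ i j, 0 < J η i j := by
      intro i j
      rw [hJ]
      fin_cases i <;> fin_cases j <;> simp [errorMatrix] <;> positivity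
    have hρ : specRadius (J η) < 1 := by
      refine spectralRadius_lt_one_of_mulVec_lt (w := ![ε₁, ε₂, ε₃])
        (fun i j => (hJpos i j).le) (fun i => ?_) fun i => ?_
      · fin_cases i <;> simpa
      · rw [hJ]
        exact errorMatrix_mulVec_lt hη (c := α * n * (πr ⬝ᵥ πc)) (by positivity) (by positivity)
          (by positivity) hlam1 hε₂' hη1 hη3 i
    refine ⟨hρ, fun x₀ => ?_⟩
    have hρ1 : (specRadius (J η)).toReal < 1 :=
      ENNReal.toReal_lt_of_lt_ofReal (by simpa using hρ)
    obtain ⟨v, hv⟩ := exists_le_spectralRadius_pow hJpos hρ (t := fun k =>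
      errorVec Ainf Binf NA NB xs (xIter A B f η x₀ k) (yIter A B f η x₀ k)) (hstep η hη x₀)
    have hO : (fun k => ‖xIter A B f η x₀ k - stack (fun _ => xs)‖) =O[atTop]
        fun k => (specRadius (J η)).toReal ^ k := by
      refine Asymptotics.IsBigO.of_bound (g * v 0 + v 1) (Eventually.of_forall fun k => ?_)
      rw [norm_norm, Real.norm_of_nonneg (pow_nonneg ENNReal.toReal_nonneg k)]
      refine (norm_sub_stack_le_errorVec (P := Ainf) (Q := Binf) hc xs _
        (yIter A B f η x₀ k)).trans ?_
      have h0 := mul_le_mul_of_nonneg_left (hv k 0) hg.le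
      have h1 := hv k 1
      simp only [Pi.smul_apply, smul_eq_mul] at h0 h1
      change _ ≤ g * ((specRadius (J η)).toReal ^ k * v 0) at h0
      change _ ≤ (specRadius (J η)).toReal ^ k * v 1 at h1
      linarith
    exact ⟨hO.trans_tendsto
      (tendsto_pow_atTop_nhds_zero_of_lt_one ENNReal.toReal_nonneg hρ1), hO⟩
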